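/- A \emph{metrized graph} $\Gamma$ is a finite connected graph (multiple edges and self-loops are allowed) each of whose edges $e$ is identified with a segment of length $L_e>0$; it is regarded as a topological space, and as a resistive electric circuit in which each segment has resistance equal to its length. Its total length is $\ell(\Gamma)=\sum_e L_e$, and $\Gamma$ is \emph{normalized} if $\ell(\Gamma)=1$. For points $x,y,z\in\Gamma$ (not necessarily vertices) let $j_z(x,y)$ be the voltage difference between $x$ and $z$ when unit current enters $\Gamma$ at $y$ and exits at $z$, and let $r(x,y)=j_x(y,y)$ be the resistance function. The \emph{canonical measure} $\mu_{\mathrm{can}}$ is the unique finite signed Borel measure $\mu$ on $\Gamma$ with $\mu(\Gamma)=1$ such that $j_\mu(x,x)=\int_\Gamma j_\zeta(x,x)\,d\mu(\zeta)$ does not depend on $x\in\Gamma$. The \emph{tau constant} is $\tau(\Gamma)=\tfrac12 j_{\mu_{\mathrm{can}}}(x,x)$. \textbf{Theorem.} Let $\Gamma$ be a normalized metrized graph with resistance function $r(x,y)$, and let $p,q$ be any two points of $\Gamma$. Then for every $\varepsilon>0$ there is a normalized metrized graph $\Gamma'$ such that $$\tau(\Gamma')\le \tau(\Gamma)-r(p,q)\Big(\tfrac14-\tau(\Gamma)\Big)+\varepsilon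 .$$ In particular, if $C>0$ is a constant such that $\tau(\Gamma)\ge C\,\ell(\Gamma)$ for all metrized graphs $\Gamma$ (that is, if Baker and Rumely's lower bound conjecture holds with the constant $C$), then there is no normalized metrized graph $\beta$ with $\tau(\beta)=C$. -/

import Mathlib

open MeasureTheory

/-- A metrized graph: a finite connected graph, possibly with multiple edges and self-loops, each of
whose edges `e` is oriented and parametrized by the segment `[0, len e]` with `len e > 0`. -/
structure MetrizedGraph where
  V : Type
  E : Type
  [fintypeV : Fintype V]
  [fintypeE : Fintype E]
  [nonemptyV : Nonempty V]
  src : E → V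
  tgt : E → V
  len : E → ℝ
  len_pos : ∀ e, 0 < len e
  connected : ∀ u v : V, Relation.EqvGen (fun a b => ∃ e, src e = a ∧ tgt e = b) u v

namespace MetrizedGraph

attribute [instance] fintypeV fintypeE nonemptyV

/-- The points of a metrized graph: its vertices, and the points in the interiors of its edges. -/
inductive Point (Γ : MetrizedGraph) : Type
  | vertex (v : Γ.V) : Point Γ
  | interior (e : Γ.E) (t : ℝ) (pos : 0 < t) (lt : t < Γ.len e) : Point Γ

/-- The total length `ℓ(Γ)`. -/
noncomputable def totalLength (Γ : MetrizedGraph) : ℝ := ∑ e, Γ.len e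

/-- `Γ` is normalized if its total length is `1`. -/
def IsNormalized (Γ : MetrizedGraph) : Prop := Γ.totalLength = 1

open Classical in
/-- The parametrization of the edge `e` by `[0, len e]`, extended by constants to all of `ℝ`. -/
noncomputable def edgePoint (Γ : MetrizedGraph) (e : Γ.E) (t : ℝ) : Γ.Point :=
  if h₀ : 0 < t then
    if h₁ : t < Γ.len e then .interior e t h₀ h₁ else .vertex (Γ.tgt e)
  else .vertex (Γ.src e)

/-- The topology of a metrized graph: a set is open iff its preimage in every edge is open. -/
noncomputable instance (Γ : MetrizedGraph) : TopologicalSpace Γ.Point :=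
  ⨆ e : Γ.E, TopologicalSpace.coinduced (Γ.edgePoint e) inferInstance

noncomputable instance (Γ : MetrizedGraph) : MeasurableSpace Γ.Point := borel Γ.Point

instance (Γ : MetrizedGraph) : BorelSpace Γ.Point := ⟨rfl⟩

open Classical in
/-- The sum of the directional derivatives of `f` at a point, over all directions emanating from
that point (a self-loop contributes two directions at its vertex). -/
noncomputable def sumSlopes (Γ : MetrizedGraph) (f : Γ.Point → ℝ) : Γ.Point → ℝ
  | .vertex v =>
      (∑ e : Γ.E, if Γ.src e = v then
        derivWithin (fun s => f (Γ.edgePoint e s)) (Set.Ici 0) 0 else 0) -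
      (∑ e : Γ.E, if Γ.tgt e = v then
        derivWithin (fun s => f (Γ.edgePoint e s)) (Set.Iic (Γ.len e)) (Γ.len e) else 0)
  | .interior e t _ _ =>
      derivWithin (fun s => f (Γ.edgePoint e s)) (Set.Ici t) t -
      derivWithin (fun s => f (Γ.edgePoint e s)) (Set.Iic t) t

open Classical in
/-- `f` is the potential on the resistive circuit `Γ` (the resistance of a segment being its length)
when unit current enters at `y` and exits at `z`, with reference voltage `0` at `z`.

Ohm's law: `f` is affine along every closed segment of an edge with neither `y` nor `z` in its open
interior (so `f` is continuous).  Kirchhoff's law: the net current leaving a point `x`, which is minus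
the sum of the outgoing slopes of `f`, is `1` at `y`, `-1` at `z` and `0` elsewhere (and `0` everywhere
if `y = z`).  Equivalently, `Δ f = δ_y - δ_z` and `f z = 0`, where `Δ` is the Laplacian of `Γ`. -/
structure IsPotential (Γ : MetrizedGraph) (z y : Γ.Point) (f : Γ.Point → ℝ) : Prop where
  affine : ∀ (e : Γ.E) (a b : ℝ), 0 ≤ a → a ≤ b → b ≤ Γ.len e →
    (∀ t ∈ Set.Ioo a b, Γ.edgePoint e t ≠ y ∧ Γ.edgePoint e t ≠ z) →
    ∃ c : ℝ, ∀ t ∈ Set.Icc a b, f (Γ.edgePoint e t) = f (Γ.edgePoint e a) + c * (t - a)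
  kirchhoff : ∀ x : Γ.Point,
    -Γ.sumSlopes f x = (if x = y then 1 else 0) - (if x = z then 1 else 0)
  reference : f z = 0

/-- The voltage function `j_z(x, y)`: the voltage difference between `x` and `z` when unit current
enters at `y` and exits at `z`. -/
noncomputable def voltage (Γ : MetrizedGraph) (z x y : Γ.Point) : ℝ :=
  Classical.epsilon (Γ.IsPotential z y) x

/-- The resistance function `r(x, y) = j_x(y, y)`. -/
noncomputable def resistance (Γ : MetrizedGraph) (x y : Γ.Point) : ℝ := Γ.voltage x y y

/-- `j_μ(x, y) = ∫ j_ζ(x, y) dμ(ζ)` for a finite signed Borel measure `μ` on `Γ`. -/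
noncomputable def voltageIntegral (Γ : MetrizedGraph) (μ : SignedMeasure Γ.Point)
    (x y : Γ.Point) : ℝ :=
  ∫ᵛ ζ, Γ.voltage ζ x y ∂<•μ

/-- `μ` is a finite signed Borel measure of total mass `1` for which `j_μ(x, x)` is constant. -/
def IsCanonical (Γ : MetrizedGraph) (μ : SignedMeasure Γ.Point) : Prop :=
  μ Set.univ = 1 ∧ ∀ x y : Γ.Point, Γ.voltageIntegral μ x x = Γ.voltageIntegral μ y y

/-- The canonical measure `μ_can`, the unique signed measure satisfying `IsCanonical`. -/
noncomputable def canonicalMeasure (Γ : MetrizedGraph) : SignedMeasure Γ.Point :=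
  Classical.epsilon Γ.IsCanonical

/-- The tau constant: half of the constant value of `j_μ(x, x)`, where `μ = μ_can`. -/
noncomputable def tau (Γ : MetrizedGraph) : ℝ :=
  1 / 2 * Γ.voltageIntegral Γ.canonicalMeasure
    (.vertex (Classical.arbitrary Γ.V)) (.vertex (Classical.arbitrary Γ.V))

/-- The lower bound conjecture holds with the constant `C`: `C > 0`, and `τ(Γ) ≥ C ℓ(Γ)` for all
metrized graphs `Γ`. -/
def LowerBoundConjecture (C : ℝ) : Prop :=
  0 < C ∧ ∀ Γ : MetrizedGraph, C * Γ.totalLength ≤ Γ.tau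

end MetrizedGraph

/-! The graph Γ' is built by replacing edges with copies of Γ itself. Cut every edge of Γ into n + 1
equal parts, with lengths L_i. Scale this subdivision by R = r(p, q), and put in place of its i-th
edge the copy of Γ scaled by L_i, attached at p and q. The copy has resistance R L_i between its
terminals, exactly the length of the edge it replaces, so the rest of the circuit does not notice
the exchange. The total length is the sum of the L_i, which is 1.

By `vtau_compose`, τ(Γ') = R τ(Γ) + ∑ (L_i τ(Γ) - R L_i / 4) - R b ∑ (L_i - r_i), where r_i is the
effective resistance across the i-th part and b = `tauSlope` depends only on Γ, p, q. The first two
terms give τ(Γ) - R (1/4 - τ(Γ)). Cutting into n + 1 parts divides ∑ (L_i - r_i) by n + 1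
(`exists_equal_subdivision`), so the last term is at most ε for large n.

The computation rests on `tau_eq`, which expresses the tau constant by finitely many resistances
between vertices (`vtau`). It needs the explicit Green function (`isPotential_pgreen`,
`IsPotential.unique`), an explicit canonical measure (`isCanonical_explicitMeasure`), and a Fubini
argument showing that every canonical measure yields the same constant
(`IsCanonical.voltageIntegral_eq`). The effect of one inserted piece is the identity `tau_of_piece`.

For the second assertion, the circle gives C ≤ 1/12 < 1/4. If τ(β) = C, distinct points p, q of β
have r(p, q) > 0, and the first assertion with small ε produces a normalized graph with tau constant
below C. -/

namespace MetrizedGraph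

variable {Γ : MetrizedGraph}

/-! ### Energy form, Green functions and resistances on the vertices -/

/-- The energy pairing `∫ φ' ψ'` of functions that are affine along the edges. -/
noncomputable def energy (Γ : MetrizedGraph) (φ ψ : Γ.V → ℝ) : ℝ :=
  ∑ e, (φ (Γ.tgt e) - φ (Γ.src e)) * (ψ (Γ.tgt e) - ψ (Γ.src e)) / Γ.len e

lemma len_ne_zero (e : Γ.E) : Γ.len e ≠ 0 := (Γ.len_pos e).ne'

lemma energy_comm (φ ψ : Γ.V → ℝ) : Γ.energy φ ψ = Γ.energy ψ φ := by
  simp only [energy, mul_comm]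

lemma energy_add_left (φ φ' ψ : Γ.V → ℝ) :
    Γ.energy (fun v => φ v + φ' v) ψ = Γ.energy φ ψ + Γ.energy φ' ψ := by
  simp only [energy, ← Finset.sum_add_distrib]
  exact Finset.sum_congr rfl fun e _ => by ring

lemma energy_smul_left (c : ℝ) (φ ψ : Γ.V → ℝ) :
    Γ.energy (fun v => c * φ v) ψ = c * Γ.energy φ ψ := by
  simp only [energy, Finset.mul_sum]
  exact Finset.sum_congr rfl fun e _ => by ring

lemma energy_add_right (φ ψ ψ' : Γ.V → ℝ) :
    Γ.energy φ (fun v => ψ v + ψ' v) = Γ.energy φ ψ + Γ.energy φ ψ' := by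
  rw [energy_comm, energy_add_left, energy_comm ψ, energy_comm ψ']

lemma energy_smul_right (c : ℝ) (φ ψ : Γ.V → ℝ) :
    Γ.energy φ (fun v => c * ψ v) = c * Γ.energy φ ψ := by
  rw [energy_comm, energy_smul_left, energy_comm]

lemma energy_sub_right (φ ψ ψ' : Γ.V → ℝ) :
    Γ.energy φ (fun v => ψ v - ψ' v) = Γ.energy φ ψ - Γ.energy φ ψ' := by
  simp only [energy, ← Finset.sum_sub_distrib]
  exact Finset.sum_congr rfl fun e _ => by ring

@[simp] lemma energy_const_right (φ : Γ.V → ℝ) (c : ℝ) : Γ.energy φ (fun _ => c) = 0 := by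
  simp [energy]

lemma energy_self_nonneg (φ : Γ.V → ℝ) : 0 ≤ Γ.energy φ φ :=
  Finset.sum_nonneg fun e _ => div_nonneg (mul_self_nonneg _) (Γ.len_pos e).le

lemma eq_of_forall_edge {φ : Γ.V → ℝ} (h : ∀ e, φ (Γ.tgt e) = φ (Γ.src e)) (u v : Γ.V) :
    φ u = φ v := by
  induction Γ.connected u v with
  | rel x y hxy => obtain ⟨e, rfl, rfl⟩ := hxy; exact (h e).symm
  | refl x => rfl
  | symm x y _ ih => exact ih.symm
  | trans x y z _ _ ih₁ ih₂ => exact ih₁.trans ih₂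

lemma eq_of_energy_self_eq_zero {φ : Γ.V → ℝ} (h : Γ.energy φ φ = 0) (u v : Γ.V) :
    φ u = φ v := by
  refine eq_of_forall_edge (fun e => ?_) u v
  have := (Finset.sum_eq_zero_iff_of_nonneg fun e _ =>
    div_nonneg (mul_self_nonneg _) (Γ.len_pos e).le).1 h e (Finset.mem_univ e)
  rw [div_eq_zero_iff, mul_self_eq_zero, sub_eq_zero] at this
  exact this.resolve_right (len_ne_zero e)

/-- `ψ` is the potential for unit current from `y` to `o`, in weak form. -/
structure IsGreen (Γ : MetrizedGraph) (o y : Γ.V) (ψ : Γ.V → ℝ) : Prop where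
  energy_eq : ∀ φ, Γ.energy φ ψ = φ y - φ o
  base : ψ o = 0

lemma IsGreen.unique {o y : Γ.V} {ψ ψ' : Γ.V → ℝ} (h : Γ.IsGreen o y ψ) (h' : Γ.IsGreen o y ψ') :
    ψ = ψ' := by
  funext x
  have key : Γ.energy (fun v => ψ v - ψ' v) (fun v => ψ v - ψ' v) = 0 := by
    rw [energy_sub_right, h.energy_eq, h'.energy_eq, sub_self]
  have := eq_of_energy_self_eq_zero key x o
  simp only [h.base, h'.base, sub_self] at this
  linarith

lemma exists_isGreen (o y : Γ.V) : ∃ ψ, Γ.IsGreen o y ψ := by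
  classical
  -- The energy degenerates on constants; the extra term φ(o) ψ(o) makes the form positive definite,
  -- hence invertible in finite dimension.
  let B : (Γ.V → ℝ) →ₗ[ℝ] Module.Dual ℝ (Γ.V → ℝ) :=
    LinearMap.mk₂ ℝ (fun ψ φ => Γ.energy φ ψ + φ o * ψ o)
      (fun ψ ψ' φ => by
        have := energy_add_right φ ψ ψ'
        simp only [Pi.add_def, this]; ring)
      (fun c ψ φ => by
        have := energy_smul_right c φ ψ
        simp only [Pi.smul_def, smul_eq_mul, this]; ring)
      (fun ψ φ φ' => by
        have := energy_add_left φ φ' ψ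
        simp only [Pi.add_def, this]; ring)
      (fun c ψ φ => by
        have := energy_smul_left c φ ψ
        simp only [Pi.smul_def, smul_eq_mul, this]; ring)
  have hB : ∀ ψ φ, B ψ φ = Γ.energy φ ψ + φ o * ψ o := fun ψ φ => rfl
  have inj : Function.Injective B := by
    rw [← LinearMap.ker_eq_bot, LinearMap.ker_eq_bot']
    intro ψ hψ
    have h0 : Γ.energy ψ ψ + ψ o * ψ o = 0 := by rw [← hB, hψ]; rfl
    have h1 : Γ.energy ψ ψ = 0 := by
      linarith [energy_self_nonneg ψ, mul_self_nonneg (ψ o)]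
    have h2 : ψ o = 0 := mul_self_eq_zero.1 (by linarith)
    funext v
    rw [eq_of_energy_self_eq_zero h1 v o, h2]; rfl
  have surj : Function.Surjective B :=
    (LinearMap.injective_iff_surjective_of_finrank_eq_finrank
      Subspace.dual_finrank_eq.symm).1 inj
  obtain ⟨ψ, hψ⟩ := surj
    (LinearMap.proj (R := ℝ) (φ := fun _ : Γ.V => ℝ) y - LinearMap.proj o)
  have key : ∀ φ, Γ.energy φ ψ + φ o * ψ o = φ y - φ o := fun φ => by rw [← hB, hψ]; rfl
  -- Testing against the constant 1 shows that the extra term vanishes.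
  have h0 : ψ o = 0 := by
    have := key fun _ => 1
    rwa [energy_comm, energy_const_right, zero_add, one_mul, sub_self] at this
  exact ⟨ψ, fun φ => by simpa [h0] using key φ, h0⟩

/-- The Green function `j_o(x, y)` on the vertices. -/
noncomputable def green (Γ : MetrizedGraph) (o y : Γ.V) : Γ.V → ℝ :=
  Classical.choose (exists_isGreen o y)

lemma isGreen_green (o y : Γ.V) : Γ.IsGreen o y (Γ.green o y) :=
  Classical.choose_spec (exists_isGreen o y)

lemma IsGreen.eq {o y : Γ.V} {ψ : Γ.V → ℝ} (h : Γ.IsGreen o y ψ) : Γ.green o y = ψ :=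
  (isGreen_green o y).unique h

lemma energy_green (o y : Γ.V) (φ : Γ.V → ℝ) : Γ.energy φ (Γ.green o y) = φ y - φ o :=
  (isGreen_green o y).energy_eq φ

@[simp] lemma green_base (o y : Γ.V) : Γ.green o y o = 0 := (isGreen_green o y).base

/-- Both values equal the energy pairing of the two Green functions, which is symmetric. -/
lemma green_comm (o x y : Γ.V) : Γ.green o x y = Γ.green o y x := by
  have h₁ := energy_green o y (Γ.green o x)
  have h₂ := energy_green o x (Γ.green o y)
  rw [energy_comm, h₂] at h₁
  simpa using h₁.symm

@[simp] lemma green_self_base (o y : Γ.V) : Γ.green o o y = 0 := by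
  rw [green_comm, green_base]

/-- The resistance between two vertices. -/
noncomputable def vres (Γ : MetrizedGraph) (u v : Γ.V) : ℝ := Γ.green u v v

lemma green_change_base (o o' y x : Γ.V) : Γ.green o' y x =
    Γ.green o y x - Γ.green o o' x - (Γ.green o y o' - Γ.green o o' o') := by
  have : Γ.IsGreen o' y fun x =>
      Γ.green o y x - Γ.green o o' x - (Γ.green o y o' - Γ.green o o' o') := by
    refine ⟨fun φ => ?_, by simp⟩
    rw [energy_sub_right, energy_sub_right, energy_const_right, energy_green, energy_green]
    ring
  rw [this.eq]

lemma vres_eq (o u v : Γ.V) :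
    Γ.vres u v = Γ.green o u u + Γ.green o v v - 2 * Γ.green o u v := by
  rw [vres, green_change_base o, green_comm o v u]; ring

@[simp] lemma vres_self (u : Γ.V) : Γ.vres u u = 0 := green_base u u

lemma vres_nonneg (u v : Γ.V) : 0 ≤ Γ.vres u v := by
  have := energy_green u v (Γ.green u v)
  rw [green_base, sub_zero] at this
  rw [vres, ← this]
  exact energy_self_nonneg _

/-- The resistance is the energy of the Green function. If it vanished, that function would be
constant, and pairing it with the indicator of v would give 0 instead of 1. -/
lemma vres_pos {u v : Γ.V} (h : u ≠ v) : 0 < Γ.vres u v := by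
  classical
  refine lt_of_le_of_ne (vres_nonneg u v) fun h0 => ?_
  have h1 := energy_green u v (Γ.green u v)
  rw [green_base, sub_zero, ← vres, ← h0] at h1
  have h2 := energy_green u v (Pi.single v 1)
  have h3 : Γ.green u v = fun _ => Γ.green u v u :=
    funext fun x => eq_of_energy_self_eq_zero h1 x u
  rw [h3, energy_const_right] at h2
  simp [h] at h2

/-- The effective resistance between the endpoints of an edge. -/
noncomputable def eres (Γ : MetrizedGraph) (e : Γ.E) : ℝ := Γ.vres (Γ.src e) (Γ.tgt e)

/-- The tau constant as an expression in the resistances between vertices. -/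
noncomputable def vtau (Γ : MetrizedGraph) (o : Γ.V) : ℝ :=
  1 / 12 * ∑ e, (Γ.len e - Γ.eres e) ^ 2 / Γ.len e + 1 / 4 * Γ.energy (Γ.vres o) (Γ.vres o)

/-- A local form of Foster's theorem. -/
lemma sum_vertices_sub_sum_edges (o : Γ.V) (φ : Γ.V → ℝ) :
    2 * ∑ v, φ v - ∑ e, Γ.eres e / Γ.len e * (φ (Γ.src e) + φ (Γ.tgt e)) =
      Γ.energy (Γ.vres o) φ + 2 * φ o := by
  classical
  -- The equation of each Green function is tested against φ(v) times the indicator of its own pole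
  -- v, and the results are summed over v. For φ = 1 the lemma becomes Foster's identity ∑ r_e / L_e
  -- = |V| - 1.
  have h1 : ∀ v, Γ.energy (fun x => if x = v then φ v else 0) (Γ.green o v) =
      φ v - if o = v then φ v else 0 := fun v => by rw [energy_green]; simp
  have h2 : ∑ v, Γ.energy (fun x => if x = v then φ v else 0) (Γ.green o v) =
      ∑ v, φ v - φ o := by
    simp [h1, Finset.sum_sub_distrib]
  have h3 : ∑ v, Γ.energy (fun x => if x = v then φ v else 0) (Γ.green o v) =
      ∑ e, (φ (Γ.tgt e) * (Γ.green o (Γ.tgt e) (Γ.tgt e) - Γ.green o (Γ.tgt e) (Γ.src e)) -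
        φ (Γ.src e) * (Γ.green o (Γ.src e) (Γ.tgt e) - Γ.green o (Γ.src e) (Γ.src e)))
          / Γ.len e := by
    simp only [energy]
    rw [Finset.sum_comm]
    refine Finset.sum_congr rfl fun e _ => ?_
    rw [← Finset.sum_div]
    simp only [sub_mul, Finset.sum_sub_distrib, ite_mul, zero_mul, Finset.sum_ite_eq,
      Finset.mem_univ, if_true]
  have h4 : ∑ v, φ v = ∑ e, (φ (Γ.tgt e) * (Γ.green o (Γ.tgt e) (Γ.tgt e)
      - Γ.green o (Γ.tgt e) (Γ.src e)) -
        φ (Γ.src e) * (Γ.green o (Γ.src e) (Γ.tgt e) - Γ.green o (Γ.src e) (Γ.src e)))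
          / Γ.len e + φ o := by rw [← h3, h2]; ring
  rw [h4, energy, mul_add, Finset.mul_sum, add_sub_right_comm, ← Finset.sum_sub_distrib]
  congr 1
  refine Finset.sum_congr rfl fun e _ => ?_
  rw [eres, vres_eq o, vres, vres, green_comm o (Γ.tgt e) (Γ.src e)]
  ring

/-! ### The Green function on all points, and the existence of potentials -/

/-- The extension of a function on the vertices that is affine along the edges. -/
noncomputable def pext (φ : Γ.V → ℝ) : Γ.Point → ℝ
  | .vertex v => φ v
  | .interior e t _ _ => φ (Γ.src e) + t / Γ.len e * (φ (Γ.tgt e) - φ (Γ.src e))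

open Classical in
/-- The coordinate of a point in the interior of the edge `e`, and `0` for all other points. -/
noncomputable def pos (e : Γ.E) : Γ.Point → ℝ
  | .vertex _ => 0
  | .interior e' t _ _ => if e' = e then t else 0

open Classical in
/-- The Green function with Dirichlet boundary conditions at the vertices. -/
noncomputable def ploc : Γ.Point → Γ.Point → ℝ
  | _, .vertex _ => 0
  | y, .interior e t _ _ => min t (pos e y) - t * pos e y / Γ.len e

/-- The restriction to the vertices of the Green function based at `o`, with pole at `y`. -/
noncomputable def vgreen (o : Γ.V) (y : Γ.Point) (u : Γ.V) : ℝ :=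
  pext (fun w => Γ.green o w u) y

/-- The Green function based at the vertex `o`, with pole at `y`. -/
noncomputable def pgreen (o : Γ.V) (y x : Γ.Point) : ℝ :=
  pext (vgreen o y) x + ploc y x

lemma edgePoint_zero (e : Γ.E) : Γ.edgePoint e 0 = .vertex (Γ.src e) := by
  simp [edgePoint]

lemma edgePoint_len (e : Γ.E) : Γ.edgePoint e (Γ.len e) = .vertex (Γ.tgt e) := by
  simp [edgePoint, Γ.len_pos e]

lemma edgePoint_interior {e : Γ.E} {t : ℝ} (h₀ : 0 < t) (h₁ : t < Γ.len e) :
    Γ.edgePoint e t = .interior e t h₀ h₁ := by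
  simp [edgePoint, h₀, h₁]

lemma edgePoint_cases {e : Γ.E} {t : ℝ} (ht : t ∈ Set.Icc 0 (Γ.len e)) :
    t = 0 ∨ t = Γ.len e ∨ ∃ (h₀ : 0 < t) (h₁ : t < Γ.len e),
      Γ.edgePoint e t = .interior e t h₀ h₁ := by
  rcases ht.1.eq_or_lt with h | h₀
  · exact .inl h.symm
  rcases ht.2.eq_or_lt with h | h₁
  · exact .inr (.inl h)
  · exact .inr (.inr ⟨h₀, h₁, edgePoint_interior h₀ h₁⟩)

lemma pos_nonneg (e : Γ.E) (y : Γ.Point) : 0 ≤ pos e y := by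
  rcases y with v | ⟨e', t, h₀, h₁⟩ <;> simp only [pos, le_refl]
  split_ifs <;> simp [h₀.le]

lemma pos_lt (e : Γ.E) (y : Γ.Point) : pos e y < Γ.len e := by
  rcases y with v | ⟨e', t, h₀, h₁⟩
  · exact Γ.len_pos e
  · simp only [pos]
    split_ifs with h
    · exact h ▸ h₁
    · exact Γ.len_pos e

lemma edgePoint_pos {e : Γ.E} {y : Γ.Point} (h : 0 < pos e y) : Γ.edgePoint e (pos e y) = y := by
  rcases y with v | ⟨e', t, h₀, h₁⟩
  · simp [pos] at h
  · by_cases he : e' = e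
    · subst he
      simp [pos, edgePoint_interior h₀ h₁]
    · simp [pos, he] at h

lemma pos_interior_self (e : Γ.E) (t : ℝ) (h₀ : 0 < t) (h₁ : t < Γ.len e) :
    pos e (.interior e t h₀ h₁) = t := by simp [pos]

lemma interior_eq_iff {e : Γ.E} {t : ℝ} (h₀ : 0 < t) (h₁ : t < Γ.len e) (y : Γ.Point) :
    .interior e t h₀ h₁ = y ↔ t = pos e y := by
  constructor
  · rintro rfl
    simp [pos]
  · intro h
    rw [← edgePoint_interior h₀ h₁, h]
    exact edgePoint_pos (h ▸ h₀)

lemma pext_edgePoint (φ : Γ.V → ℝ) {e : Γ.E} {t : ℝ} (ht : t ∈ Set.Icc 0 (Γ.len e)) :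
    pext φ (Γ.edgePoint e t) = φ (Γ.src e) + t / Γ.len e * (φ (Γ.tgt e) - φ (Γ.src e)) := by
  rcases edgePoint_cases ht with rfl | rfl | ⟨h₀, h₁, h⟩
  · simp [edgePoint_zero, pext]
  · simp [edgePoint_len, pext, div_self (len_ne_zero e)]
  · rw [h, pext]

lemma ploc_edgePoint (y : Γ.Point) {e : Γ.E} {t : ℝ} (ht : t ∈ Set.Icc 0 (Γ.len e)) :
    ploc y (Γ.edgePoint e t) = min t (pos e y) - t * pos e y / Γ.len e := by
  rcases edgePoint_cases ht with rfl | rfl | ⟨h₀, h₁, h⟩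
  · simp [edgePoint_zero, ploc, pos_nonneg]
  · rw [edgePoint_len, ploc, min_eq_right (pos_lt e y).le, mul_div_cancel_left₀ _ (len_ne_zero e),
      sub_self]
  · rw [h, ploc]

lemma pgreen_edgePoint (o : Γ.V) (y : Γ.Point) {e : Γ.E} {t : ℝ}
    (ht : t ∈ Set.Icc 0 (Γ.len e)) :
    pgreen o y (Γ.edgePoint e t) = vgreen o y (Γ.src e) +
      t / Γ.len e * (vgreen o y (Γ.tgt e) - vgreen o y (Γ.src e)) +
      (min t (pos e y) - t * pos e y / Γ.len e) := by
  rw [pgreen, pext_edgePoint _ ht, ploc_edgePoint y ht]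

lemma ploc_comm (x y : Γ.Point) : ploc x y = ploc y x := by
  rcases x with v | ⟨e, t, h₀, h₁⟩ <;> rcases y with w | ⟨e', t', h₀', h₁'⟩ <;>
    simp only [ploc, pos]
  · simp [h₀'.le]
  · simp [h₀.le]
  · by_cases h : e = e'
    · subst h; simp [min_comm, mul_comm]
    · simp [h, Ne.symm h, h₀.le, h₀'.le]

lemma pgreen_comm (o : Γ.V) (x y : Γ.Point) : pgreen o x y = pgreen o y x := by
  rw [pgreen, pgreen, ploc_comm]
  congr 1
  rcases x with v | ⟨e, t, h₀, h₁⟩ <;> rcases y with w | ⟨e', t', h₀', h₁'⟩ <;>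
    simp only [pext, vgreen]
  · exact green_comm _ _ _
  · rw [green_comm o v, green_comm o v]
  · rw [green_comm o _ w, green_comm o _ w]
  · rw [green_comm o (Γ.src e) (Γ.src e'), green_comm o (Γ.tgt e) (Γ.src e'),
      green_comm o (Γ.src e) (Γ.tgt e'), green_comm o (Γ.tgt e) (Γ.tgt e')]
    ring

@[simp] lemma pgreen_base (o : Γ.V) (y : Γ.Point) : pgreen o y (.vertex o) = 0 := by
  rcases y with v | ⟨e, t, h₀, h₁⟩ <;> simp [pgreen, pext, vgreen, ploc]

/-- Seen from the vertices, a pole inside an edge acts like poles at the two ends with barycentric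
weights. -/
lemma energy_vgreen (o : Γ.V) (y : Γ.Point) (φ : Γ.V → ℝ) :
    Γ.energy φ (vgreen o y) = pext φ y - φ o := by
  rcases y with v | ⟨e, t, h₀, h₁⟩
  · exact energy_green o v φ
  · change Γ.energy φ (fun u => Γ.green o (Γ.src e) u +
      t / Γ.len e * (Γ.green o (Γ.tgt e) u - Γ.green o (Γ.src e) u)) = _
    rw [energy_add_right, energy_smul_right, energy_sub_right, energy_green, energy_green]
    simp only [pext]; ring

lemma hasDerivWithinAt_Ici_of_affine {F : ℝ → ℝ} {a b c k : ℝ} (hab : a < b)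
    (h : ∀ t ∈ Set.Icc a b, F t = k + c * (t - a)) : HasDerivWithinAt F c (Set.Ici a) a := by
  have h1 : HasDerivWithinAt (fun t => k + c * (t - a)) c (Set.Ici a) a := by
    simpa using ((((hasDerivAt_id a).sub_const a).const_mul c).const_add k).hasDerivWithinAt
  refine h1.congr_of_eventuallyEq ?_ (h a ⟨le_rfl, hab.le⟩)
  filter_upwards [self_mem_nhdsWithin, mem_nhdsWithin_of_mem_nhds (Iio_mem_nhds hab)] with t h1 h2
  exact h t ⟨h1, le_of_lt h2⟩

lemma hasDerivWithinAt_Iic_of_affine {F : ℝ → ℝ} {a b c k : ℝ} (hab : a < b)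
    (h : ∀ t ∈ Set.Icc a b, F t = k + c * (t - a)) : HasDerivWithinAt F c (Set.Iic b) b := by
  have h1 : HasDerivWithinAt (fun t => k + c * (t - a)) c (Set.Iic b) b := by
    simpa using ((((hasDerivAt_id b).sub_const a).const_mul c).const_add k).hasDerivWithinAt
  refine h1.congr_of_eventuallyEq ?_ (h b ⟨hab.le, le_rfl⟩)
  filter_upwards [self_mem_nhdsWithin, mem_nhdsWithin_of_mem_nhds (Ioi_mem_nhds hab)] with t h1 h2
  exact h t ⟨le_of_lt h2, h1⟩

/-- The right slope carries the condition `t < pos e y`, the left slope below `t ≤ pos e y`; the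
difference is the unit jump at an interior pole. If y is not inside e, then `pos e y = 0` and the
tent contributes nothing. -/
lemma hasDerivWithinAt_pgreen_right (o : Γ.V) (y : Γ.Point) {e : Γ.E} {t : ℝ} (h₀ : 0 ≤ t)
    (h₁ : t < Γ.len e) :
    HasDerivWithinAt (fun s => pgreen o y (Γ.edgePoint e s))
      ((vgreen o y (Γ.tgt e) - vgreen o y (Γ.src e)) / Γ.len e - pos e y / Γ.len e +
        if t < pos e y then 1 else 0) (Set.Ici t) t := by
  split_ifs with h
  · refine hasDerivWithinAt_Ici_of_affine (k := pgreen o y (Γ.edgePoint e t)) h fun s hs => ?_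
    rw [pgreen_edgePoint o y ⟨h₀.trans hs.1, hs.2.trans (pos_lt e y).le⟩,
      pgreen_edgePoint o y ⟨h₀, h₁.le⟩, min_eq_left hs.2, min_eq_left h.le]
    ring
  · refine hasDerivWithinAt_Ici_of_affine (k := pgreen o y (Γ.edgePoint e t)) h₁ fun s hs => ?_
    rw [pgreen_edgePoint o y ⟨h₀.trans hs.1, hs.2⟩,
      pgreen_edgePoint o y ⟨h₀, h₁.le⟩, min_eq_right ((not_lt.1 h).trans hs.1),
      min_eq_right (not_lt.1 h)]
    ring

lemma hasDerivWithinAt_pgreen_left (o : Γ.V) (y : Γ.Point) {e : Γ.E} {t : ℝ} (h₀ : 0 < t)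
    (h₁ : t ≤ Γ.len e) :
    HasDerivWithinAt (fun s => pgreen o y (Γ.edgePoint e s))
      ((vgreen o y (Γ.tgt e) - vgreen o y (Γ.src e)) / Γ.len e - pos e y / Γ.len e +
        if t ≤ pos e y then 1 else 0) (Set.Iic t) t := by
  split_ifs with h
  · refine hasDerivWithinAt_Iic_of_affine (k := pgreen o y (Γ.edgePoint e 0)) h₀ fun s hs => ?_
    rw [pgreen_edgePoint o y ⟨hs.1, hs.2.trans h₁⟩, pgreen_edgePoint o y ⟨le_rfl, h₀.le.trans h₁⟩,
      min_eq_left (hs.2.trans h), min_eq_left (h₀.le.trans h)]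
    ring
  · refine hasDerivWithinAt_Iic_of_affine (k := pgreen o y (Γ.edgePoint e (pos e y)))
      (not_le.1 h) fun s hs => ?_
    rw [pgreen_edgePoint o y ⟨(pos_nonneg e y).trans hs.1, hs.2.trans h₁⟩,
      pgreen_edgePoint o y ⟨pos_nonneg e y, (pos_lt e y).le⟩, min_eq_right hs.1, min_self]
    ring

-- This is `energy_vgreen` tested against the indicator of v. The identity `h2` in the proof
-- accounts for the end slopes of the tent on the edge containing y, which compensate the
-- barycentric weights of y.
open Classical in
lemma sum_slopes_vertex (o : Γ.V) (y : Γ.Point) (v : Γ.V) :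
    (∑ e, if Γ.src e = v then (vgreen o y (Γ.tgt e) - vgreen o y (Γ.src e)) / Γ.len e -
        pos e y / Γ.len e + (if 0 < pos e y then 1 else 0) else 0) -
      (∑ e, if Γ.tgt e = v then (vgreen o y (Γ.tgt e) - vgreen o y (Γ.src e)) / Γ.len e -
        pos e y / Γ.len e + (if Γ.len e ≤ pos e y then 1 else 0) else 0) =
      (if v = o then 1 else 0) - if .vertex v = y then 1 else 0 := by
  have h1 := energy_vgreen o y (Pi.single v 1)
  have h2 : (∑ e, if Γ.src e = v then -(pos e y / Γ.len e) + (if 0 < pos e y then 1 else 0) else 0)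
      + (∑ e, if Γ.tgt e = v then pos e y / Γ.len e else 0) =
        pext (Pi.single v 1) y - if .vertex v = y then 1 else 0 := by
    rcases y with w | ⟨e', t, h₀, h₁⟩
    · simp [pos, pext, Pi.single_apply, eq_comm]
    · rw [← Finset.sum_add_distrib, Finset.sum_eq_single e']
      · simp only [pos, pext, Pi.single_apply, h₀, if_true]
        split_ifs <;> (simp_all; try ring)
      · intro e _ he
        simp [pos, he.symm]
      · simp
  have h3 : (if v = o then (1 : ℝ) else 0) - (if .vertex v = y then 1 else 0) =
      (pext (Pi.single v 1) y - if .vertex v = y then 1 else 0) -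
        (pext (Pi.single v 1) y - (Pi.single v 1 : Γ.V → ℝ) o) := by
    simp only [Pi.single_apply, eq_comm]; ring
  rw [h3, ← h1, ← h2, energy, ← Finset.sum_sub_distrib, ← Finset.sum_add_distrib,
    ← Finset.sum_sub_distrib]
  refine Finset.sum_congr rfl fun e _ => ?_
  rw [if_neg (not_le.2 (pos_lt e y))]
  simp only [Pi.single_apply]
  split_ifs <;> ring

lemma pos_notMem_Ioo {e : Γ.E} {y : Γ.Point} {a b : ℝ} (ha : 0 ≤ a)
    (h : ∀ t ∈ Set.Ioo a b, Γ.edgePoint e t ≠ y) : pos e y ≤ a ∨ b ≤ pos e y := by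
  by_contra! hc
  exact h _ hc (edgePoint_pos (ha.trans_lt hc.1))

lemma pgreen_affine (o : Γ.V) (y : Γ.Point) (e : Γ.E) {a b : ℝ} (ha : 0 ≤ a) (hab : a ≤ b)
    (hb : b ≤ Γ.len e) (h : ∀ t ∈ Set.Ioo a b, Γ.edgePoint e t ≠ y) :
    ∃ c : ℝ, ∀ t ∈ Set.Icc a b,
      pgreen o y (Γ.edgePoint e t) = pgreen o y (Γ.edgePoint e a) + c * (t - a) := by
  rcases pos_notMem_Ioo ha h with h | h
  · refine ⟨(vgreen o y (Γ.tgt e) - vgreen o y (Γ.src e)) / Γ.len e - pos e y / Γ.len e,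
      fun t ht => ?_⟩
    rw [pgreen_edgePoint o y ⟨ha.trans ht.1, ht.2.trans hb⟩, pgreen_edgePoint o y ⟨ha, hab.trans hb⟩,
      min_eq_right (h.trans ht.1), min_eq_right h]
    ring
  · refine ⟨(vgreen o y (Γ.tgt e) - vgreen o y (Γ.src e)) / Γ.len e - pos e y / Γ.len e + 1,
      fun t ht => ?_⟩
    rw [pgreen_edgePoint o y ⟨ha.trans ht.1, ht.2.trans hb⟩, pgreen_edgePoint o y ⟨ha, hab.trans hb⟩,
      min_eq_left (ht.2.trans h), min_eq_left (hab.trans h)]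
    ring

/-- Subtracting the Green functions with poles y and z cancels the sink at the auxiliary base o; the
constant normalizes the value at z. -/
theorem isPotential_pgreen (o : Γ.V) (z y : Γ.Point) : Γ.IsPotential z y fun x =>
    pgreen o y x - pgreen o z x - (pgreen o y z - pgreen o z z) where
  affine e a b ha hab hb h := by
    obtain ⟨c, hc⟩ := pgreen_affine o y e ha hab hb fun t ht => (h t ht).1
    obtain ⟨d, hd⟩ := pgreen_affine o z e ha hab hb fun t ht => (h t ht).2
    exact ⟨c - d, fun t ht => by rw [hc t ht, hd t ht]; ring⟩
  kirchhoff x := by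
    classical
    have hR : ∀ e t, 0 ≤ t → t < Γ.len e → _ := fun e t h₀ h₁ =>
      (((hasDerivWithinAt_pgreen_right o y h₀ h₁).sub
        (hasDerivWithinAt_pgreen_right o z h₀ h₁)).sub_const
          (pgreen o y z - pgreen o z z)).derivWithin (uniqueDiffWithinAt_Ici t)
    have hL : ∀ e t, 0 < t → t ≤ Γ.len e → _ := fun e t h₀ h₁ =>
      (((hasDerivWithinAt_pgreen_left o y h₀ h₁).sub
        (hasDerivWithinAt_pgreen_left o z h₀ h₁)).sub_const
          (pgreen o y z - pgreen o z z)).derivWithin (uniqueDiffWithinAt_Iic t)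
    simp only [Pi.sub_def] at hR hL
    rcases x with v | ⟨e, t, h₀, h₁⟩
    · simp only [sumSlopes]
      have hy := sum_slopes_vertex o y v
      have hz := sum_slopes_vertex o z v
      have e1 : ∀ e, derivWithin (fun s => pgreen o y (Γ.edgePoint e s) -
          pgreen o z (Γ.edgePoint e s) - (pgreen o y z - pgreen o z z)) (Set.Ici 0) 0 = _ :=
        fun e => hR e 0 le_rfl (Γ.len_pos e)
      have e2 : ∀ e, derivWithin (fun s => pgreen o y (Γ.edgePoint e s) -
          pgreen o z (Γ.edgePoint e s) - (pgreen o y z - pgreen o z z)) (Set.Iic (Γ.len e))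
            (Γ.len e) = _ :=
        fun e => hL e _ (Γ.len_pos e) le_rfl
      simp only [e1, e2]
      have hs : ∀ (P : Prop) [Decidable P] (a b : ℝ), (if P then a - b else 0) =
          (if P then a else 0) - if P then b else 0 := fun P _ a b => by split_ifs <;> simp
      simp only [hs, Finset.sum_sub_distrib]
      linarith
    · simp only [sumSlopes]
      rw [hR e t h₀.le h₁, hL e t h₀ h₁.le]
      have hs : ∀ p : ℝ, (if t < p then (1 : ℝ) else 0) =
          (if t ≤ p then 1 else 0) - if t = p then 1 else 0 := fun p => by
        rcases lt_trichotomy t p with h | h | h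
        · simp [h, h.le, h.ne]
        · simp [h]
        · simp [not_le.2 h, not_lt.2 h.le, h.ne']
      rw [hs, hs]
      simp only [interior_eq_iff]
      ring
  reference := by ring

/-! ### Uniqueness of potentials, and the formula for the voltage -/

lemma affine_glue {F : ℝ → ℝ} {a b c : ℝ} (hab : a ≤ b) (hbc : b ≤ c)
    (h₁ : ∃ k : ℝ, ∀ t ∈ Set.Icc a b, F t = F a + k * (t - a))
    (h₂ : ∃ k : ℝ, ∀ t ∈ Set.Icc b c, F t = F b + k * (t - b))
    (hs : a < b → b < c → derivWithin F (Set.Ici b) b = derivWithin F (Set.Iic b) b) :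
    ∃ k : ℝ, ∀ t ∈ Set.Icc a c, F t = F a + k * (t - a) := by
  rcases hab.eq_or_lt with rfl | hab'
  · exact h₂
  rcases hbc.eq_or_lt with rfl | hbc'
  · exact h₁
  obtain ⟨k₁, h₁⟩ := h₁
  obtain ⟨k₂, h₂⟩ := h₂
  have hs := hs hab' hbc'
  rw [(hasDerivWithinAt_Ici_of_affine hbc' h₂).derivWithin (uniqueDiffWithinAt_Ici b),
    (hasDerivWithinAt_Iic_of_affine hab' h₁).derivWithin (uniqueDiffWithinAt_Iic b)] at hs
  subst hs
  refine ⟨k₂, fun t ht => ?_⟩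
  rcases le_total t b with h | h
  · exact h₁ t ⟨ht.1, h⟩
  · rw [h₂ t ⟨h, ht.2⟩, h₁ b ⟨hab, le_rfl⟩]; ring

lemma eq_pos_of_edgePoint_eq {e : Γ.E} {t : ℝ} {y : Γ.Point} (h₀ : 0 < t) (h₁ : t < Γ.len e)
    (h : Γ.edgePoint e t = y) : t = pos e y := by
  rwa [edgePoint_interior h₀ h₁, interior_eq_iff] at h

lemma IsPotential.affine_of_pos {z y : Γ.Point} {f : Γ.Point → ℝ} (hf : Γ.IsPotential z y f)
    {e : Γ.E} {a b : ℝ} (ha : 0 ≤ a) (hab : a ≤ b) (hb : b ≤ Γ.len e)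
    (hy : pos e y ≤ a ∨ b ≤ pos e y) (hz : pos e z ≤ a ∨ b ≤ pos e z) :
    ∃ c : ℝ, ∀ t ∈ Set.Icc a b, f (Γ.edgePoint e t) = f (Γ.edgePoint e a) + c * (t - a) := by
  refine hf.affine e a b ha hab hb fun t ht => ⟨fun h => ?_, fun h => ?_⟩
  · have := eq_pos_of_edgePoint_eq (ha.trans_lt ht.1) (ht.2.trans_le hb) h
    rcases hy with h | h <;> linarith [ht.1, ht.2]
  · have := eq_pos_of_edgePoint_eq (ha.trans_lt ht.1) (ht.2.trans_le hb) h
    rcases hz with h | h <;> linarith [ht.1, ht.2]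

/-- Supplies an interval starting at t with neither pole in its interior, so that a potential is
affine there and has a right slope at t. -/
lemma exists_gt_and_le_or_le {t L : ℝ} (h : t < L) (p q : ℝ) :
    ∃ b, t < b ∧ b ≤ L ∧ (p ≤ t ∨ b ≤ p) ∧ (q ≤ t ∨ b ≤ q) := by
  rcases le_or_gt p t with hp | hp <;> rcases le_or_gt q t with hq | hq
  · exact ⟨L, h, le_rfl, .inl hp, .inl hq⟩
  · exact ⟨min L q, lt_min h hq, min_le_left _ _, .inl hp, .inr (min_le_right _ _)⟩
  · exact ⟨min L p, lt_min h hp, min_le_left _ _, .inr (min_le_right _ _), .inl hq⟩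
  · exact ⟨min L (min p q), lt_min h (lt_min hp hq), min_le_left _ _,
      .inr ((min_le_right _ _).trans (min_le_left _ _)),
      .inr ((min_le_right _ _).trans (min_le_right _ _))⟩

lemma IsPotential.exists_slope_right {z y : Γ.Point} {f : Γ.Point → ℝ} (hf : Γ.IsPotential z y f)
    {e : Γ.E} {t : ℝ} (h₀ : 0 ≤ t) (h₁ : t < Γ.len e) :
    ∃ c, HasDerivWithinAt (fun s => f (Γ.edgePoint e s)) c (Set.Ici t) t := by
  obtain ⟨b, htb, hb, hy, hz⟩ := exists_gt_and_le_or_le h₁ (pos e y) (pos e z)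
  obtain ⟨c, hc⟩ := hf.affine_of_pos h₀ htb.le hb hy hz
  exact ⟨c, hasDerivWithinAt_Ici_of_affine htb hc⟩

lemma IsPotential.exists_slope_left {z y : Γ.Point} {f : Γ.Point → ℝ} (hf : Γ.IsPotential z y f)
    {e : Γ.E} {t : ℝ} (h₀ : 0 < t) (h₁ : t ≤ Γ.len e) :
    ∃ c, HasDerivWithinAt (fun s => f (Γ.edgePoint e s)) c (Set.Iic t) t := by
  -- The left-hand case is the right-hand one after the reflection t ↦ -t, with 0 as the far end.
  obtain ⟨b, htb, hb, hy, hz⟩ := exists_gt_and_le_or_le (neg_lt_zero.2 h₀) (-pos e y) (-pos e z)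
  obtain ⟨c, hc⟩ := hf.affine_of_pos (neg_nonneg.2 hb) (neg_le.1 htb.le) h₁
    (hy.symm.imp le_neg_of_le_neg neg_le_neg_iff.1) (hz.symm.imp le_neg_of_le_neg neg_le_neg_iff.1)
  exact ⟨c, hasDerivWithinAt_Iic_of_affine (neg_lt.1 htb) hc⟩

lemma IsPotential.sumSlopes_sub {z y : Γ.Point} {f f' : Γ.Point → ℝ} (hf : Γ.IsPotential z y f)
    (hf' : Γ.IsPotential z y f') (x : Γ.Point) : Γ.sumSlopes (fun x => f x - f' x) x = 0 := by
  classical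
  have hR : ∀ e t, 0 ≤ t → t < Γ.len e → derivWithin
      (fun s => f (Γ.edgePoint e s) - f' (Γ.edgePoint e s)) (Set.Ici t) t =
      derivWithin (fun s => f (Γ.edgePoint e s)) (Set.Ici t) t -
      derivWithin (fun s => f' (Γ.edgePoint e s)) (Set.Ici t) t := fun e t h₀ h₁ => by
    obtain ⟨c, hc⟩ := hf.exists_slope_right h₀ h₁
    obtain ⟨d, hd⟩ := hf'.exists_slope_right h₀ h₁
    have hu := uniqueDiffWithinAt_Ici t
    rw [hc.derivWithin hu, hd.derivWithin hu]
    exact (hc.sub hd).derivWithin hu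
  have hL : ∀ e t, 0 < t → t ≤ Γ.len e → derivWithin
      (fun s => f (Γ.edgePoint e s) - f' (Γ.edgePoint e s)) (Set.Iic t) t =
      derivWithin (fun s => f (Γ.edgePoint e s)) (Set.Iic t) t -
      derivWithin (fun s => f' (Γ.edgePoint e s)) (Set.Iic t) t := fun e t h₀ h₁ => by
    obtain ⟨c, hc⟩ := hf.exists_slope_left h₀ h₁
    obtain ⟨d, hd⟩ := hf'.exists_slope_left h₀ h₁
    have hu := uniqueDiffWithinAt_Iic t
    rw [hc.derivWithin hu, hd.derivWithin hu]
    exact (hc.sub hd).derivWithin hu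
  have h1 := hf.kirchhoff x
  have h2 := hf'.kirchhoff x
  rw [← h1, neg_inj] at h2
  rw [← sub_eq_zero] at h2
  rw [← neg_zero, ← h2, neg_sub]
  rcases x with v | ⟨e, t, h₀, h₁⟩
  · have e1 : ∀ e, derivWithin (fun s => f (Γ.edgePoint e s) - f' (Γ.edgePoint e s))
        (Set.Ici 0) 0 = _ := fun e => hR e 0 le_rfl (Γ.len_pos e)
    have e2 : ∀ e, derivWithin (fun s => f (Γ.edgePoint e s) - f' (Γ.edgePoint e s))
        (Set.Iic (Γ.len e)) (Γ.len e) = _ := fun e => hL e _ (Γ.len_pos e) le_rfl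
    have hs : ∀ (P : Prop) [Decidable P] (a b : ℝ), (if P then a - b else 0) =
        (if P then a else 0) - if P then b else 0 := fun P _ a b => by split_ifs <;> simp
    simp only [sumSlopes, e1, e2, hs, Finset.sum_sub_distrib]
    ring
  · simp only [sumSlopes, hR e t h₀.le h₁, hL e t h₀ h₁.le]
    ring

/-- The difference d of two potentials has no poles, so it is affine along whole edges with zero net
slope at every vertex. Summation by parts shows that its energy is 0; hence d is constant, and it
vanishes at z. -/
theorem IsPotential.unique {z y : Γ.Point} {f f' : Γ.Point → ℝ} (hf : Γ.IsPotential z y f)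
    (hf' : Γ.IsPotential z y f') : f = f' := by
  classical
  let d : Γ.Point → ℝ := fun x => f x - f' x
  have haff : ∀ e : Γ.E, ∀ a b, 0 ≤ a → a ≤ b → b ≤ Γ.len e → (pos e y ≤ a ∨ b ≤ pos e y) →
      (pos e z ≤ a ∨ b ≤ pos e z) → ∃ c : ℝ, ∀ t ∈ Set.Icc a b,
        d (Γ.edgePoint e t) = d (Γ.edgePoint e a) + c * (t - a) := by
    intro e a b ha hab hb hy hz
    obtain ⟨c, hc⟩ := hf.affine_of_pos ha hab hb hy hz
    obtain ⟨c', hc'⟩ := hf'.affine_of_pos ha hab hb hy hz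
    exact ⟨c - c', fun t ht => by simp only [d, hc t ht, hc' t ht]; ring⟩
  have hslope : ∀ (e : Γ.E) (t : ℝ), 0 < t → t < Γ.len e →
      derivWithin (fun s => d (Γ.edgePoint e s)) (Set.Ici t) t =
      derivWithin (fun s => d (Γ.edgePoint e s)) (Set.Iic t) t := by
    intro e t h₀ h₁
    have := hf.sumSlopes_sub hf' (.interior e t h₀ h₁)
    exact sub_eq_zero.1 this
  have hedge : ∀ e : Γ.E, ∃ c : ℝ, ∀ t ∈ Set.Icc 0 (Γ.len e),
      d (Γ.edgePoint e t) = d (Γ.edgePoint e 0) + c * (t - 0) := by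
    -- The edge is cut at the positions of y and z. The difference is affine on the three parts, and
    -- its slopes match at the cuts.
    intro e
    have hm : 0 ≤ min (pos e y) (pos e z) := le_min (pos_nonneg e y) (pos_nonneg e z)
    have hM : max (pos e y) (pos e z) < Γ.len e := max_lt (pos_lt e y) (pos_lt e z)
    have hmM : min (pos e y) (pos e z) ≤ max (pos e y) (pos e z) :=
      min_le_max
    refine affine_glue (F := fun s => d (Γ.edgePoint e s)) (hm.trans hmM) hM.le
      (affine_glue (F := fun s => d (Γ.edgePoint e s)) hm hmM ?_ ?_ ?_) ?_ ?_
    · exact haff e _ _ le_rfl hm (hmM.trans hM.le) (.inr (min_le_left _ _))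
        (.inr (min_le_right _ _))
    · refine haff e _ _ hm hmM hM.le ?_ ?_
      · rcases le_total (pos e y) (pos e z) with h | h
        · exact .inl (by rw [min_eq_left h])
        · exact .inr (by rw [max_eq_left h])
      · rcases le_total (pos e y) (pos e z) with h | h
        · exact .inr (by rw [max_eq_right h])
        · exact .inl (by rw [min_eq_right h])
    · exact fun h₀ h₁ => hslope e _ h₀ (h₁.trans hM)
    · exact haff e _ _ (hm.trans hmM) hM.le le_rfl (.inl (le_max_left _ _))
        (.inl (le_max_right _ _))
    · exact fun h₀ h₁ => hslope e _ h₀ h₁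
  choose c hc using hedge
  have hD : ∀ e, d (.vertex (Γ.tgt e)) - d (.vertex (Γ.src e)) = c e * Γ.len e := fun e => by
    have := hc e (Γ.len e) ⟨(Γ.len_pos e).le, le_rfl⟩
    rw [edgePoint_len, edgePoint_zero] at this
    rw [this]; ring
  have hv : ∀ v, ∑ e, ((if Γ.tgt e = v then c e else 0) - if Γ.src e = v then c e else 0) = 0 := by
    intro v
    have h := hf.sumSlopes_sub hf' (.vertex v)
    have e1 : ∀ e, derivWithin (fun s => f (Γ.edgePoint e s) - f' (Γ.edgePoint e s))
        (Set.Ici 0) 0 = c e := fun e =>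
      (hasDerivWithinAt_Ici_of_affine (Γ.len_pos e) (hc e)).derivWithin (uniqueDiffWithinAt_Ici 0)
    have e2 : ∀ e, derivWithin (fun s => f (Γ.edgePoint e s) - f' (Γ.edgePoint e s))
        (Set.Iic (Γ.len e)) (Γ.len e) = c e := fun e =>
      (hasDerivWithinAt_Iic_of_affine (Γ.len_pos e) (hc e)).derivWithin (uniqueDiffWithinAt_Iic _)
    simp only [sumSlopes, e1, e2] at h
    rw [Finset.sum_sub_distrib]
    linarith
  have hE : Γ.energy (fun v => d (.vertex v)) (fun v => d (.vertex v)) = 0 := by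
    have : Γ.energy (fun v => d (.vertex v)) (fun v => d (.vertex v)) = ∑ v, d (.vertex v) *
        ∑ e, ((if Γ.tgt e = v then c e else 0) - if Γ.src e = v then c e else 0) := by
      simp only [Finset.mul_sum]
      rw [Finset.sum_comm]
      refine Finset.sum_congr rfl fun e _ => ?_
      simp only [mul_sub, Finset.sum_sub_distrib, mul_ite, mul_zero, Finset.sum_ite_eq,
        Finset.mem_univ, if_true]
      rw [← sub_mul, hD]
      field_simp [len_ne_zero e]
      rw [hD]; ring
    rw [this]
    exact Finset.sum_eq_zero fun v _ => by rw [hv, mul_zero]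
  have hconst := eq_of_energy_self_eq_zero hE
  have hc0 : ∀ e, c e = 0 := fun e => by
    have := hD e
    rw [hconst (Γ.tgt e) (Γ.src e), sub_self] at this
    exact (mul_eq_zero.1 this.symm).resolve_right (len_ne_zero e)
  have hpt : ∀ x, d x = d (.vertex (Classical.arbitrary Γ.V)) := by
    rintro (v | ⟨e, t, h₀, h₁⟩)
    · exact hconst _ _
    · rw [← edgePoint_interior h₀ h₁, hc e t ⟨h₀.le, h₁.le⟩, hc0, edgePoint_zero, zero_mul, add_zero]
      exact hconst _ _
  funext x
  have : d x = d z := by rw [hpt x, hpt z]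
  simp only [d, hf.reference, hf'.reference, sub_self] at this
  linarith

theorem voltage_eq (o : Γ.V) (z x y : Γ.Point) : Γ.voltage z x y =
    pgreen o y x - pgreen o z x - (pgreen o y z - pgreen o z z) := by
  have h := isPotential_pgreen o z y
  rw [voltage, (Classical.epsilon_spec (p := Γ.IsPotential z y) ⟨_, h⟩).unique h]

theorem resistance_eq (o : Γ.V) (x y : Γ.Point) : Γ.resistance x y =
    pgreen o x x + pgreen o y y - 2 * pgreen o x y := by
  rw [resistance, voltage_eq o, pgreen_comm o y x]; ring

theorem voltage_self (o : Γ.V) (z x : Γ.Point) : Γ.voltage z x x =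
    pgreen o x x + pgreen o z z - 2 * pgreen o x z := by
  rw [voltage_eq o, pgreen_comm o z x]; ring

/-! ### Continuity, compactness and integrability -/

lemma continuous_edgePoint (e : Γ.E) : Continuous (Γ.edgePoint e) :=
  continuous_iSup_rng continuous_coinduced_rng

lemma edgePoint_clamp (e : Γ.E) (t : ℝ) :
    Γ.edgePoint e (max 0 (min t (Γ.len e))) = Γ.edgePoint e t := by
  rcases le_or_gt t 0 with h | h
  · rw [max_eq_left ((min_le_left _ _).trans h)]
    simp [edgePoint, not_lt.2 h]
  · rw [max_eq_right (le_min h.le (Γ.len_pos e).le)]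
    rcases le_or_gt (Γ.len e) t with h' | h'
    · rw [min_eq_right h']
      simp [edgePoint, h, not_lt.2 h', Γ.len_pos e]
    · rw [min_eq_left h'.le]

lemma continuous_of_edges {f : Γ.Point → ℝ} (F : Γ.E → ℝ → ℝ) (hF : ∀ e, Continuous (F e))
    (h : ∀ e, ∀ t ∈ Set.Icc 0 (Γ.len e), f (Γ.edgePoint e t) = F e t) : Continuous f := by
  refine continuous_iSup_dom.2 fun e => continuous_coinduced_dom.2 ?_
  have : f ∘ Γ.edgePoint e = fun t => F e (max 0 (min t (Γ.len e))) := by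
    funext t
    rw [← h e _ ⟨le_max_left _ _, max_le (Γ.len_pos e).le (min_le_right _ _)⟩, edgePoint_clamp]
    rfl
  rw [this]
  exact (hF e).comp (by fun_prop)

instance : CompactSpace Γ.Point where
  isCompact_univ := by
    -- The vertices are listed separately because a one-vertex graph may have no edge to cover it.
    have : (Set.univ : Set Γ.Point) = (⋃ v, {.vertex v}) ∪
        ⋃ e, Γ.edgePoint e '' Set.Icc 0 (Γ.len e) := by
      refine (Set.eq_univ_of_forall ?_).symm
      rintro (v | ⟨e, t, h₀, h₁⟩)
      · exact .inl (Set.mem_iUnion.2 ⟨v, rfl⟩)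
      · exact .inr (Set.mem_iUnion.2 ⟨e, t, ⟨h₀.le, h₁.le⟩, edgePoint_interior h₀ h₁⟩)
    rw [this]
    exact (isCompact_iUnion fun v => isCompact_singleton).union
      (isCompact_iUnion fun e => isCompact_Icc.image (continuous_edgePoint e))

lemma exists_bound {f : Γ.Point → ℝ} (hf : Continuous f) : ∃ C, ∀ x, ‖f x‖ ≤ C := by
  obtain ⟨C, hC⟩ := isCompact_univ.exists_bound_of_continuousOn hf.continuousOn
  exact ⟨C, fun x => hC x trivial⟩

lemma integrable_of_continuous {f : Γ.Point → ℝ} (hf : Continuous f) (μ : Measure Γ.Point)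
    [IsFiniteMeasure μ] : Integrable f μ := by
  obtain ⟨C, hC⟩ := exists_bound hf
  exact Integrable.of_bound hf.measurable.aestronglyMeasurable C (.of_forall hC)

lemma continuous_pgreen (o : Γ.V) (y : Γ.Point) : Continuous (pgreen o y) :=
  continuous_of_edges _ (fun e => by fun_prop) fun e t ht => pgreen_edgePoint o y ht

/-! ### An explicit canonical measure -/

/-- The density `1 / (L_e + R_e)` of the canonical measure on the edge `e`. -/
noncomputable def canonicalDensity (e : Γ.E) : ℝ := (Γ.len e - Γ.eres e) / Γ.len e ^ 2

/-- Interpolating the vertex Green function in both arguments at s = t / L_e gives an affine part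
minus s (1 - s) r_e, while the tent contributes s (1 - s) L_e. Together the quadratic part is t (L_e
- t) times the canonical density. -/
lemma pgreen_self (o : Γ.V) (x : Γ.Point) : pgreen o x x = pext (Γ.vres o) x +
    ∑ e, canonicalDensity e * (pos e x * (Γ.len e - pos e x)) := by
  rcases x with v | ⟨e, t, h₀, h₁⟩
  · simp [pgreen, pext, vgreen, ploc, pos, vres]
  · rw [Finset.sum_eq_single e]
    · have := len_ne_zero e
      simp only [pgreen, pext, vgreen, ploc, pos, if_true, min_self, canonicalDensity, eres,
        vres_eq o (Γ.src e), vres_eq o o, green_self_base, green_comm o (Γ.tgt e) (Γ.src e)]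
      field_simp
      ring
    · intro e' _ he'
      simp [pos, he'.symm]
    · simp

lemma pgreen_self_edgePoint (o : Γ.V) {e : Γ.E} {t : ℝ} (ht : t ∈ Set.Icc 0 (Γ.len e)) :
    pgreen o (Γ.edgePoint e t) (Γ.edgePoint e t) = Γ.vres o (Γ.src e) +
      t / Γ.len e * (Γ.vres o (Γ.tgt e) - Γ.vres o (Γ.src e)) +
      canonicalDensity e * (t * (Γ.len e - t)) := by
  rw [pgreen_self, pext_edgePoint _ ht]
  congr 1
  rcases edgePoint_cases ht with rfl | rfl | ⟨h₀, h₁, h⟩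
  · simp [edgePoint_zero, pos]
  · simp [edgePoint_len, pos]
  · rw [h, Finset.sum_eq_single e]
    · simp [pos]
    · intro e' _ he'
      simp [pos, he'.symm]
    · simp

lemma continuous_pgreen_self (o : Γ.V) : Continuous fun x : Γ.Point => pgreen o x x :=
  continuous_of_edges _ (fun e => by fun_prop) fun e t ht => pgreen_self_edgePoint o ht

lemma continuous_voltage (x : Γ.Point) : Continuous fun ζ => Γ.voltage ζ x x := by
  have o := Classical.arbitrary Γ.V
  simp only [voltage_self o]
  exact (continuous_const.add (continuous_pgreen_self o)).sub
    ((continuous_pgreen o x).const_mul 2)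

lemma voltage_symm (x y : Γ.Point) : Γ.voltage x y y = Γ.voltage y x x := by
  have o := Classical.arbitrary Γ.V
  rw [voltage_self o, voltage_self o, pgreen_comm o y x]; ring

/-- Lebesgue measure on the edge `e`. -/
noncomputable def edgeMeasure (e : Γ.E) : Measure Γ.Point :=
  (volume.restrict (Set.Ioc 0 (Γ.len e))).map (Γ.edgePoint e)

instance (e : Γ.E) : IsFiniteMeasure (edgeMeasure e) := by
  unfold edgeMeasure; infer_instance

lemma integral_edgeMeasure {f : Γ.Point → ℝ} (hf : Continuous f) (e : Γ.E) :
    ∫ x, f x ∂edgeMeasure e = ∫ t in (0 : ℝ)..Γ.len e, f (Γ.edgePoint e t) := by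
  rw [edgeMeasure, integral_map (continuous_edgePoint e).measurable.aemeasurable
    hf.measurable.aestronglyMeasurable, intervalIntegral.integral_of_le (Γ.len_pos e).le]

/-- The canonical measure, explicitly. -/
noncomputable def explicitMeasure (Γ : MetrizedGraph) : SignedMeasure Γ.Point :=
  ∑ v, VectorMeasure.dirac (.vertex v) 1 -
    ∑ e, (1 / 2 : ℝ) • (VectorMeasure.dirac (.vertex (Γ.src e)) 1 +
      VectorMeasure.dirac (.vertex (Γ.tgt e)) 1) +
    ∑ e, canonicalDensity e • (edgeMeasure e).toSignedMeasure

/-- The integral of a function against the canonical measure, explicitly. -/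
noncomputable def canonicalSum (Γ : MetrizedGraph) (f : Γ.Point → ℝ) : ℝ :=
  ∑ v, f (.vertex v) - ∑ e, 1 / 2 * (f (.vertex (Γ.src e)) + f (.vertex (Γ.tgt e))) +
    ∑ e, canonicalDensity e * ∫ t in (0 : ℝ)..Γ.len e, f (Γ.edgePoint e t)

instance (μ : SignedMeasure Γ.Point) : IsFiniteMeasure (VectorMeasure.variation μ) := by
  rw [← SignedMeasure.totalVariation_eq_variation]; infer_instance

lemma integral_explicitMeasure {f : Γ.Point → ℝ} (hf : Continuous f) :
    ∫ᵛ x, f x ∂<•Γ.explicitMeasure = Γ.canonicalSum f := by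
  have hi : ∀ μ : SignedMeasure Γ.Point, VectorMeasure.Integrable μ f := fun μ =>
    integrable_of_continuous hf _
  have hd : ∀ v : Γ.V, ∫ᵛ x, f x ∂<•(VectorMeasure.dirac (.vertex v) (1 : ℝ)) = f (.vertex v) :=
    fun v => by rw [VectorMeasure.integral_dirac' hf.measurable.stronglyMeasurable]; simp
  rw [explicitMeasure, VectorMeasure.integral_add_vectorMeasure (hi _) (hi _),
    VectorMeasure.integral_sub_vectorMeasure (hi _) (hi _),
    VectorMeasure.integral_finsetSum_vectorMeasure fun _ _ => hi _,
    VectorMeasure.integral_finsetSum_vectorMeasure fun _ _ => hi _,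
    VectorMeasure.integral_finsetSum_vectorMeasure fun _ _ => hi _]
  simp only [VectorMeasure.integral_smul_vectorMeasure,
    VectorMeasure.integral_add_vectorMeasure (hi _) (hi _), hd,
    VectorMeasure.integral_toSignedMeasure, integral_edgeMeasure hf, smul_eq_mul]
  rfl

/-- The trapezoidal part of the edge integrals cancels the negative point masses up to the weights
r_e / L_e. The local Foster theorem turns what is left into an energy pairing, and only the
deviations X from the trapezoidal rule survive. -/
lemma canonicalSum_eq {f : Γ.Point → ℝ} {X : Γ.E → ℝ} (o : Γ.V)
    (hX : ∀ e, ∫ t in (0 : ℝ)..Γ.len e, f (Γ.edgePoint e t) =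
      Γ.len e * ((f (.vertex (Γ.src e)) + f (.vertex (Γ.tgt e))) / 2) + X e) :
    Γ.canonicalSum f = 1 / 2 * Γ.energy (Γ.vres o) (fun v => f (.vertex v)) + f (.vertex o) +
      ∑ e, canonicalDensity e * X e := by
  have h := sum_vertices_sub_sum_edges o fun v => f (.vertex v)
  have h1 : ∑ e, canonicalDensity e *
      (Γ.len e * ((f (.vertex (Γ.src e)) + f (.vertex (Γ.tgt e))) / 2) + X e) =
      ∑ e, 1 / 2 * (f (.vertex (Γ.src e)) + f (.vertex (Γ.tgt e))) - 1 / 2 *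
        ∑ e, Γ.eres e / Γ.len e * (f (.vertex (Γ.src e)) + f (.vertex (Γ.tgt e))) +
      ∑ e, canonicalDensity e * X e := by
    rw [Finset.mul_sum, ← Finset.sum_sub_distrib, ← Finset.sum_add_distrib]
    refine Finset.sum_congr rfl fun e _ => ?_
    have := len_ne_zero e
    rw [canonicalDensity]
    field_simp
  simp only [canonicalSum, hX, h1]
  linarith

lemma integral_affine (L a b : ℝ) (hL : L ≠ 0) :
    ∫ t in (0 : ℝ)..L, (a + t / L * (b - a)) = L * ((a + b) / 2) := by
  rw [intervalIntegral.integral_add (by simp) (by apply Continuous.intervalIntegrable; fun_prop),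
    intervalIntegral.integral_mul_const, intervalIntegral.integral_div, integral_id]
  simp only [intervalIntegral.integral_const, smul_eq_mul]
  field_simp
  ring

lemma integral_tent {L τ : ℝ} (h₀ : 0 ≤ τ) (h₁ : τ < L) :
    ∫ t in (0 : ℝ)..L, (min t τ - t * τ / L) = τ * (L - τ) / 2 := by
  have hL : L ≠ 0 := (h₀.trans_lt h₁).ne'
  have hc : ∀ a b : ℝ, IntervalIntegrable (fun t => min t τ) volume a b := fun a b => by
    apply Continuous.intervalIntegrable; fun_prop
  rw [intervalIntegral.integral_sub (hc _ _) (by apply Continuous.intervalIntegrable; fun_prop),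
    ← intervalIntegral.integral_add_adjacent_intervals (hc 0 τ) (hc τ L)]
  have h1 : ∫ t in (0 : ℝ)..τ, min t τ = ∫ t in (0 : ℝ)..τ, t :=
    intervalIntegral.integral_congr fun t ht => by
      rw [Set.uIcc_of_le h₀] at ht; exact min_eq_left ht.2
  have h2 : ∫ t in τ..L, min t τ = ∫ t in τ..L, τ :=
    intervalIntegral.integral_congr fun t ht => by
      rw [Set.uIcc_of_le h₁.le] at ht; exact min_eq_right ht.1
  rw [h1, h2, intervalIntegral.integral_div, intervalIntegral.integral_mul_const, integral_id,
    integral_id, intervalIntegral.integral_const, smul_eq_mul]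
  field_simp
  ring

lemma integral_mul_sub (L : ℝ) : ∫ t in (0 : ℝ)..L, t * (L - t) = L ^ 3 / 6 := by
  have : ∀ t : ℝ, t * (L - t) = t * L - t ^ 2 := fun t => by ring
  simp only [this]
  rw [intervalIntegral.integral_sub (by apply Continuous.intervalIntegrable; fun_prop)
    (by apply Continuous.intervalIntegrable; fun_prop), intervalIntegral.integral_mul_const,
    integral_id, integral_pow]
  norm_num
  ring

/-- This is the equilibrium property: in the integral over ζ of g(x, x) + g(ζ, ζ) - 2 g(x, ζ), it
makes the terms depending on x cancel. `canonicalSum_pgreen_self` evaluates the constant that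
remains. -/
lemma canonicalSum_pgreen (o : Γ.V) (x : Γ.Point) :
    2 * Γ.canonicalSum (pgreen o x) = pgreen o x x := by
  have hv : ∀ v, pgreen o x (.vertex v) = vgreen o x v := fun v => by simp [pgreen, pext, ploc]
  rw [canonicalSum_eq o (X := fun e => pos e x * (Γ.len e - pos e x) / 2), pgreen_self,
    pgreen_base]
  · simp only [hv]
    rw [energy_vgreen, vres_self, mul_add, mul_add, Finset.mul_sum]
    congr 1
    · ring
    · exact Finset.sum_congr rfl fun e _ => by ring
  · intro e
    have h := len_ne_zero e
    rw [hv, hv, ← integral_affine _ _ _ h, ← integral_tent (pos_nonneg e x) (pos_lt e x),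
      ← intervalIntegral.integral_add (by apply Continuous.intervalIntegrable; fun_prop)
        (by apply Continuous.intervalIntegrable; fun_prop)]
    refine intervalIntegral.integral_congr fun t ht => ?_
    rw [Set.uIcc_of_le (Γ.len_pos e).le] at ht
    exact pgreen_edgePoint o x ht

lemma canonicalSum_pgreen_self (o : Γ.V) :
    Γ.canonicalSum (fun x => pgreen o x x) = 2 * Γ.vtau o := by
  have hv : ∀ v, pgreen o (.vertex v) (.vertex v) = Γ.vres o v := fun v => by
    simp [pgreen, pext, vgreen, ploc, vres]
  rw [canonicalSum_eq o (X := fun e => canonicalDensity e * (Γ.len e ^ 3 / 6)), vtau]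
  · simp only [hv, vres_self]
    rw [mul_add, Finset.mul_sum, Finset.mul_sum, add_comm]
    congr 1
    · refine Finset.sum_congr rfl fun e _ => ?_
      have := len_ne_zero e
      rw [canonicalDensity]
      field_simp
      ring
    · ring
  · intro e
    have h := len_ne_zero e
    rw [hv, hv, ← integral_affine _ _ _ h, ← integral_mul_sub,
      ← intervalIntegral.integral_const_mul,
      ← intervalIntegral.integral_add (by apply Continuous.intervalIntegrable; fun_prop)
        (by apply Continuous.intervalIntegrable; fun_prop)]
    refine intervalIntegral.integral_congr fun t ht => ?_
    rw [Set.uIcc_of_le (Γ.len_pos e).le] at ht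
    exact pgreen_self_edgePoint o ht

lemma canonicalSum_const (c : ℝ) : Γ.canonicalSum (fun _ => c) = c := by
  have o := Classical.arbitrary Γ.V
  rw [canonicalSum_eq o (X := fun _ => 0)]
  · simp
  · intro e
    simp

lemma explicitMeasure_univ : Γ.explicitMeasure Set.univ = 1 := by
  have h := integral_explicitMeasure (Γ := Γ) (f := fun _ => 1) continuous_const
  rw [canonicalSum_const, VectorMeasure.integral_const] at h
  simpa using h

lemma voltageIntegral_explicitMeasure (o : Γ.V) (x : Γ.Point) :
    Γ.voltageIntegral Γ.explicitMeasure x x = 2 * Γ.vtau o := by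
  have hi : ∀ {f : Γ.Point → ℝ}, Continuous f → VectorMeasure.Integrable Γ.explicitMeasure f :=
    fun hf => integrable_of_continuous hf _
  have h1 := continuous_pgreen_self o
  have h2 := (continuous_pgreen o x).const_mul 2
  have h0 : Continuous fun _ : Γ.Point => pgreen o x x := continuous_const
  simp only [voltageIntegral, voltage_self o]
  rw [VectorMeasure.integral_fun_sub (f := fun ζ => pgreen o x x + pgreen o ζ ζ)
      (hi (h0.add h1)) (hi h2), VectorMeasure.integral_fun_add (hi h0) (hi h1), integral_explicitMeasure h1,
    integral_explicitMeasure h0, canonicalSum_const, canonicalSum_pgreen_self]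
  have h3 := VectorMeasure.integral_fun_smul Γ.explicitMeasure
    (ContinuousLinearMap.lsmul ℝ ℝ (E := ℝ)).flip 2 (pgreen o x)
  simp only [smul_eq_mul] at h3
  rw [h3, integral_explicitMeasure (continuous_pgreen o x), canonicalSum_pgreen]
  ring

lemma canonicalSum_voltage (o : Γ.V) (x : Γ.Point) :
    Γ.canonicalSum (fun ζ => Γ.voltage ζ x x) = 2 * Γ.vtau o := by
  rw [← integral_explicitMeasure (continuous_voltage x), ← voltageIntegral_explicitMeasure o x,
    voltageIntegral]

lemma isCanonical_explicitMeasure : Γ.IsCanonical Γ.explicitMeasure := by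
  have o := Classical.arbitrary Γ.V
  exact ⟨explicitMeasure_univ, fun x y => by
    rw [voltageIntegral_explicitMeasure o, voltageIntegral_explicitMeasure o]⟩

/-! ### The constant does not depend on the canonical measure -/

lemma exists_bound_pgreen (o : Γ.V) (e : Γ.E) :
    ∃ C, ∀ ζ t, |pgreen o ζ (Γ.edgePoint e t)| ≤ C := by
  -- In t the function is affine up to a tent of height at most L_e, so bounds at the two ends of e
  -- suffice, uniformly in ζ.
  obtain ⟨A, hA⟩ := exists_bound (continuous_pgreen o (.vertex (Γ.src e)))
  obtain ⟨B, hB⟩ := exists_bound (continuous_pgreen o (.vertex (Γ.tgt e)))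
  have hv : ∀ ζ v, pgreen o (.vertex v) ζ = vgreen o ζ v := fun ζ v => by
    rw [pgreen_comm]; simp [pgreen, pext, ploc]
  simp only [hv, Real.norm_eq_abs] at hA hB
  refine ⟨A + (B + A) + Γ.len e, fun ζ t => ?_⟩
  rw [← edgePoint_clamp]
  have ht : max 0 (min t (Γ.len e)) ∈ Set.Icc 0 (Γ.len e) :=
    ⟨le_max_left _ _, max_le (Γ.len_pos e).le (min_le_right _ _)⟩
  generalize max 0 (min t (Γ.len e)) = t at ht
  have hL := Γ.len_pos e
  rw [pgreen_edgePoint o ζ ht]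
  have h1 : |min t (pos e ζ) - t * pos e ζ / Γ.len e| ≤ Γ.len e := by
    have hp := pos_nonneg e ζ
    have hp' := (pos_lt e ζ).le
    have h2 : 0 ≤ t * pos e ζ / Γ.len e := div_nonneg (mul_nonneg ht.1 hp) hL.le
    have h3 : t * pos e ζ / Γ.len e ≤ Γ.len e := by
      rw [div_le_iff₀ hL]; exact mul_le_mul ht.2 hp' hp hL.le
    have h4 : 0 ≤ min t (pos e ζ) := le_min ht.1 hp
    have h5 : min t (pos e ζ) ≤ Γ.len e := (min_le_left _ _).trans ht.2
    rw [abs_le]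
    constructor <;> linarith
  have h2 : |t / Γ.len e * (vgreen o ζ (Γ.tgt e) - vgreen o ζ (Γ.src e))| ≤ B + A := by
    rw [abs_mul]
    have h3 : |t / Γ.len e| ≤ 1 := by
      rw [abs_of_nonneg (div_nonneg ht.1 hL.le)]; exact (div_le_one hL).2 ht.2
    calc _ ≤ 1 * |vgreen o ζ (Γ.tgt e) - vgreen o ζ (Γ.src e)| :=
          mul_le_mul_of_nonneg_right h3 (abs_nonneg _)
      _ ≤ B + A := by rw [one_mul]; exact (abs_sub _ _).trans (add_le_add (hB ζ) (hA ζ))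
  exact (abs_add_le _ _).trans (add_le_add ((abs_add_le _ _).trans (add_le_add (hA ζ) h2)) h1)

lemma integrable_voltage_prod (P : Measure Γ.Point) [IsFiniteMeasure P] (e : Γ.E) :
    Integrable (Function.uncurry fun (t : ℝ) (ζ : Γ.Point) =>
      Γ.voltage ζ (Γ.edgePoint e t) (Γ.edgePoint e t))
      ((volume.restrict (Set.uIoc 0 (Γ.len e))).prod P) := by
  have o := Classical.arbitrary Γ.V
  have hm : Measurable (Function.uncurry fun (t : ℝ) (ζ : Γ.Point) =>
      Γ.voltage ζ (Γ.edgePoint e t) (Γ.edgePoint e t)) :=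
    -- Joint measurability follows from continuity in t and measurability in ζ; the symmetry of the
    -- resistance yields the former.
    measurable_uncurry_of_continuous_of_measurable
      (fun ζ => by
        simp only [fun t => voltage_symm ζ (Γ.edgePoint e t)]
        exact (continuous_voltage ζ).comp (continuous_edgePoint e))
      (fun t => (continuous_voltage _).measurable)
  obtain ⟨C, hC⟩ := exists_bound (continuous_pgreen_self (Γ := Γ) o)
  obtain ⟨D, hD⟩ := exists_bound_pgreen o e
  have : IsFiniteMeasure (volume.restrict (Set.uIoc 0 (Γ.len e))) := by
    rw [Set.uIoc_of_le (Γ.len_pos e).le]; infer_instance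
  refine Integrable.of_bound hm.aestronglyMeasurable (C + C + 2 * D) (.of_forall ?_)
  rintro ⟨t, ζ⟩
  have h1 := abs_le.1 (hC ζ)
  have h2 := abs_le.1 (hC (Γ.edgePoint e t))
  have h3 := abs_le.1 (hD ζ t)
  simp only [Function.uncurry, Real.norm_eq_abs, voltage_self o, pgreen_comm o _ ζ]
  rw [abs_le]
  constructor <;> linarith [h1.1, h1.2, h2.1, h2.2, h3.1, h3.2]

lemma canonicalSum_integral (o : Γ.V) (P : Measure Γ.Point) [IsFiniteMeasure P] :
    Γ.canonicalSum (fun x => ∫ ζ, Γ.voltage ζ x x ∂P) = 2 * Γ.vtau o * P.real Set.univ := by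
  have hi : ∀ x, Integrable (fun ζ => Γ.voltage ζ x x) P := fun x =>
    integrable_of_continuous (continuous_voltage x) P
  have h1 : ∫ ζ, Γ.canonicalSum (fun x => Γ.voltage ζ x x) ∂P = 2 * Γ.vtau o * P.real Set.univ := by
    have h : ∀ ζ, Γ.canonicalSum (fun x => Γ.voltage ζ x x) = 2 * Γ.vtau o := fun ζ => by
      simp only [fun x => voltage_symm ζ x]
      exact canonicalSum_voltage o ζ
    simp only [h, integral_const, smul_eq_mul]
    ring
  rw [← h1]
  have hj : ∀ e : Γ.E, Integrable (fun ζ => ∫ t in (0 : ℝ)..Γ.len e,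
      Γ.voltage ζ (Γ.edgePoint e t) (Γ.edgePoint e t)) P := fun e => by
    have := (integrable_voltage_prod P e).integral_prod_right
    simpa only [Function.uncurry, intervalIntegral.integral_of_le (Γ.len_pos e).le,
      Set.uIoc_of_le (Γ.len_pos e).le] using this
  simp only [canonicalSum]
  rw [integral_add, integral_sub, integral_finsetSum, integral_finsetSum, integral_finsetSum]
  · simp only [integral_const_mul]
    congr 2
    · congr 1
      funext e
      rw [integral_add (hi _) (hi _)]
    · funext e
      rw [intervalIntegral_integral_swap (integrable_voltage_prod P e)]
  · exact fun e _ => (hj e).const_mul _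
  · exact fun e _ => ((hi _).add (hi _)).const_mul _
  · exact fun v _ => hi _
  · exact integrable_finsetSum _ fun v _ => hi _
  · exact integrable_finsetSum _ fun e _ => ((hi _).add (hi _)).const_mul _
  · exact (integrable_finsetSum _ fun v _ => hi _).sub
      (integrable_finsetSum _ fun e _ => ((hi _).add (hi _)).const_mul _)
  · exact integrable_finsetSum _ fun e _ => (hj e).const_mul _

lemma canonicalSum_sub {f g : Γ.Point → ℝ}
    (hf : ∀ e, IntervalIntegrable (fun t => f (Γ.edgePoint e t)) volume 0 (Γ.len e))
    (hg : ∀ e, IntervalIntegrable (fun t => g (Γ.edgePoint e t)) volume 0 (Γ.len e)) :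
    Γ.canonicalSum (fun x => f x - g x) = Γ.canonicalSum f - Γ.canonicalSum g := by
  simp only [canonicalSum, intervalIntegral.integral_sub (hf _) (hg _), mul_sub,
    Finset.sum_sub_distrib, mul_add, Finset.sum_add_distrib]
  ring

/-- Integrate the resistance against μ and the explicit measure. In one order the inner integral is
the unknown constant of μ; in the other it is 2 `vtau`, and both measures have mass 1. Uniqueness of
the canonical measure is thus not needed. The Jordan decomposition reduces Fubini to positive
measures. -/
lemma IsCanonical.voltageIntegral_eq (o : Γ.V) {μ : SignedMeasure Γ.Point}
    (hμ : Γ.IsCanonical μ) (x : Γ.Point) : Γ.voltageIntegral μ x x = 2 * Γ.vtau o := by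
  set j := μ.toJordanDecomposition with hj
  have hμj : μ = j.posPart.toSignedMeasure - j.negPart.toSignedMeasure :=
    (SignedMeasure.toSignedMeasure_toJordanDecomposition μ).symm
  have hint : ∀ y, Γ.voltageIntegral μ y y =
      ∫ ζ, Γ.voltage ζ y y ∂j.posPart - ∫ ζ, Γ.voltage ζ y y ∂j.negPart := fun y => by
    rw [voltageIntegral, hμj, VectorMeasure.integral_sub_vectorMeasure
      (integrable_of_continuous (continuous_voltage y) _)
      (integrable_of_continuous (continuous_voltage y) _),
      VectorMeasure.integral_toSignedMeasure, VectorMeasure.integral_toSignedMeasure]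
  have hI : ∀ (P : Measure Γ.Point) [IsFiniteMeasure P] (e : Γ.E), IntervalIntegrable
      (fun t => ∫ ζ, Γ.voltage ζ (Γ.edgePoint e t) (Γ.edgePoint e t) ∂P) volume 0 (Γ.len e) :=
    fun P _ e => by
      rw [intervalIntegrable_iff]
      exact (integrable_voltage_prod P e).integral_prod_left
  have h1 : Γ.canonicalSum (fun y => Γ.voltageIntegral μ y y) = Γ.voltageIntegral μ x x := by
    simp only [fun y => hμ.2 y x, canonicalSum_const]
  rw [← h1]
  simp only [hint]
  rw [canonicalSum_sub (hI _) (hI _), canonicalSum_integral o, canonicalSum_integral o, ← mul_sub]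
  have h2 : j.posPart.real Set.univ - j.negPart.real Set.univ = 1 := by
    rw [← hμ.1, hμj, Measure.toSignedMeasure_sub_apply MeasurableSet.univ]
  rw [h2, mul_one]

theorem tau_eq (o : Γ.V) : Γ.tau = Γ.vtau o := by
  have h : Γ.IsCanonical Γ.canonicalMeasure :=
    Classical.epsilon_spec ⟨_, isCanonical_explicitMeasure⟩
  rw [tau, h.voltageIntegral_eq o]; ring

/-! ### A piece with two terminals, and its contribution to the tau constant -/

/-- The function that is harmonic away from `p` and `q`, with value `0` at `p` and `1` at `q`. -/
noncomputable def harm (p q v : Γ.V) : ℝ := Γ.green p q v / Γ.vres p q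

/-- The Green function with Dirichlet boundary conditions at `p` and `q`. -/
noncomputable def dirichlet (p q v w : Γ.V) : ℝ :=
  Γ.green p v w - Γ.vres p q * harm p q v * harm p q w

@[simp] lemma harm_left (p q : Γ.V) : harm p q p = 0 := by simp [harm]

lemma harm_right {p q : Γ.V} (h : p ≠ q) : harm p q q = 1 := div_self (vres_pos h).ne'

lemma energy_harm (p q : Γ.V) (φ : Γ.V → ℝ) :
    Γ.energy φ (harm p q) = (φ q - φ p) / Γ.vres p q := by
  have : harm p q = fun v => (Γ.vres p q)⁻¹ * Γ.green p q v := by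
    funext v; rw [harm, div_eq_inv_mul]
  rw [this, energy_smul_right, energy_green, div_eq_inv_mul]

lemma vres_mul_harm {p q : Γ.V} (h : p ≠ q) (v : Γ.V) :
    Γ.vres p q * harm p q v = Γ.green p q v := mul_div_cancel₀ _ (vres_pos h).ne'

lemma dirichlet_comm (p q v w : Γ.V) : dirichlet p q v w = dirichlet p q w v := by
  rw [dirichlet, dirichlet, green_comm]; ring

@[simp] lemma dirichlet_left (p q w : Γ.V) : dirichlet p q p w = 0 := by
  simp [dirichlet]

lemma dirichlet_right {p q : Γ.V} (h : p ≠ q) (w : Γ.V) : dirichlet p q q w = 0 := by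
  rw [dirichlet, harm_right h, mul_one, vres_mul_harm h, sub_self]

lemma energy_dirichlet {p q : Γ.V} (h : p ≠ q) (v : Γ.V) (φ : Γ.V → ℝ) :
    Γ.energy φ (dirichlet p q v) = φ v - (φ p + harm p q v * (φ q - φ p)) := by
  have hR := (vres_pos h).ne'
  change Γ.energy φ (fun w => Γ.green p v w - Γ.vres p q * harm p q v * harm p q w) = _
  rw [energy_sub_right, energy_smul_right, energy_green, energy_harm]
  field_simp
  ring

/-- The derivative of the contribution of a piece with terminals `p` and `q` to the tau constant
with respect to the effective resistance between the terminals. -/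
noncomputable def tauSlope (p q : Γ.V) : ℝ :=
  -(1 / 6) * ∑ e, (Γ.len e - Γ.eres e) * (harm p q (Γ.tgt e) - harm p q (Γ.src e)) ^ 2 / Γ.len e -
    1 / 2 * Γ.energy (Γ.vres p) (fun v => harm p q v - harm p q v ^ 2)

/-- When the piece sits in a larger graph, c is the resistance from the base point to p, D the
increase of that resistance from p to q, and δ the change of the resistance between p and q caused
by the outside. Apart from `vtau` and `tauSlope`, every term is an energy pairing with the harmonic
function, so only boundary values at p and q matter. -/
lemma tau_of_piece {p q : Γ.V} (h : p ≠ q) (c D δ : ℝ) :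
    1 / 12 * ∑ e, (Γ.len e -
        (Γ.eres e + δ * (harm p q (Γ.tgt e) - harm p q (Γ.src e)) ^ 2)) ^ 2 / Γ.len e +
      1 / 4 * Γ.energy
        (fun v => c + Γ.vres p v + (D - Γ.vres p q) * harm p q v -
          δ * (harm p q v - harm p q v ^ 2))
        (fun v => c + Γ.vres p v + (D - Γ.vres p q) * harm p q v -
          δ * (harm p q v - harm p q v ^ 2)) =
    Γ.vtau p + D ^ 2 / (4 * Γ.vres p q) - Γ.vres p q / 4 + δ ^ 2 / (12 * Γ.vres p q) +
      δ * tauSlope p q := by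
  have hR := (vres_pos h).ne'
  have h1 := energy_harm p q (harm p q)
  have h2 := energy_harm p q (Γ.vres p)
  have h3 := energy_harm p q (fun v => harm p q v - harm p q v ^ 2)
  -- The cubic is the antiderivative of (1 - 2h)² / 4. On an edge with end values a, b of h, the
  -- mean of this integrand is (1 - a - b)² / 4 + (b - a)² / 12, which collects the δ² terms of both
  -- sums. Its value 1/12 at h = 1 gives δ² / (12 r(p, q)).
  have h4 := energy_harm p q
    (fun v => (harm p q v - 2 * harm p q v ^ 2 + 4 / 3 * harm p q v ^ 3) / 4)
  simp only [harm_left, harm_right h, vres_self] at h1 h2 h3 h4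
  have key : 1 / 12 * ∑ e, (Γ.len e -
        (Γ.eres e + δ * (harm p q (Γ.tgt e) - harm p q (Γ.src e)) ^ 2)) ^ 2 / Γ.len e +
      1 / 4 * Γ.energy
        (fun v => c + Γ.vres p v + (D - Γ.vres p q) * harm p q v -
          δ * (harm p q v - harm p q v ^ 2))
        (fun v => c + Γ.vres p v + (D - Γ.vres p q) * harm p q v -
          δ * (harm p q v - harm p q v ^ 2)) =
      Γ.vtau p + (D - Γ.vres p q) ^ 2 / 4 * Γ.energy (harm p q) (harm p q) +
        (D - Γ.vres p q) / 2 * Γ.energy (Γ.vres p) (harm p q) -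
        (D - Γ.vres p q) * δ / 2 *
          Γ.energy (fun v => harm p q v - harm p q v ^ 2) (harm p q) +
        δ * tauSlope p q + δ ^ 2 * Γ.energy
          (fun v => (harm p q v - 2 * harm p q v ^ 2 + 4 / 3 * harm p q v ^ 3) / 4)
            (harm p q) := by
    simp only [vtau, tauSlope, energy, mul_add, mul_sub, Finset.mul_sum,
      ← Finset.sum_add_distrib, ← Finset.sum_sub_distrib]
    refine Finset.sum_congr rfl fun e _ => ?_
    have := len_ne_zero e
    field_simp
    ring
  rw [key, h1, h2, h3, h4]
  field_simp
  ring

/-! ### Replacing the edges of a graph by two-terminal pieces -/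

section Compose

variable (α : MetrizedGraph) (B : α.E → MetrizedGraph) (p q : ∀ i, (B i).V)

/-- The vertices of the graph obtained from `α` by replacing each edge `i` by `B i`. -/
abbrev ComposeV : Type := α.V ⊕ Σ i, {v : (B i).V // v ≠ p i ∧ v ≠ q i}

variable {α B}

open Classical in
/-- The map from the vertices of a piece to the vertices of the composite graph. -/
noncomputable def cemb (i : α.E) (v : (B i).V) : ComposeV α B p q :=
  if hp : v = p i then .inl (α.src i) else
    if hq : v = q i then .inl (α.tgt i) else .inr ⟨i, v, hp, hq⟩

lemma cemb_left (i : α.E) : cemb p q i (p i) = .inl (α.src i) := by simp [cemb]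

variable {p q}

lemma cemb_right (hpq : ∀ i, p i ≠ q i) (i : α.E) : cemb p q i (q i) = .inl (α.tgt i) := by
  simp [cemb, (hpq i).symm]

lemma cemb_inr (i : α.E) (v : {v : (B i).V // v ≠ p i ∧ v ≠ q i}) :
    cemb p q i v = .inr ⟨i, v⟩ := by
  simp [cemb, v.2.1, v.2.2]

lemma cemb_cases (hpq : ∀ i, p i ≠ q i) (i : α.E) (v : (B i).V) :
    v = p i ∨ v = q i ∨ ∃ h : v ≠ p i ∧ v ≠ q i, cemb p q i v = .inr ⟨i, v, h⟩ := by
  by_cases h1 : v = p i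
  · exact .inl h1
  by_cases h2 : v = q i
  · exact .inr (.inl h2)
  · exact .inr (.inr ⟨⟨h1, h2⟩, cemb_inr i ⟨v, h1, h2⟩⟩)

variable (α B p q)

open Classical in
/-- The graph obtained from `α` by replacing each edge `i` by the graph `B i`, with `p i` at the
source and `q i` at the target. -/
noncomputable abbrev compose (hpq : ∀ i, p i ≠ q i) : MetrizedGraph where
  V := ComposeV α B p q
  E := Σ i, (B i).E
  nonemptyV := ⟨.inl (Classical.arbitrary _)⟩
  src e := cemb p q e.1 ((B e.1).src e.2)
  tgt e := cemb p q e.1 ((B e.1).tgt e.2)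
  len e := (B e.1).len e.2
  len_pos e := (B e.1).len_pos e.2
  connected := by
    set r : ComposeV α B p q → ComposeV α B p q → Prop := fun a b => ∃ e : Σ i, (B i).E,
      cemb p q e.1 ((B e.1).src e.2) = a ∧ cemb p q e.1 ((B e.1).tgt e.2) = b
    have h1 : ∀ i v w, Relation.EqvGen r (cemb p q i v) (cemb p q i w) := by
      intro i v w
      induction (B i).connected v w with
      | rel x y hxy => obtain ⟨e, rfl, rfl⟩ := hxy; exact .rel _ _ ⟨⟨i, e⟩, rfl, rfl⟩
      | refl x => exact .refl _
      | symm x y _ ih => exact .symm _ _ ih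
      | trans x y z _ _ ih₁ ih₂ => exact .trans _ _ _ ih₁ ih₂
    have h2 : ∀ u v : α.V, Relation.EqvGen r (.inl u) (.inl v) := by
      intro u v
      induction α.connected u v with
      | rel x y hxy =>
        obtain ⟨i, rfl, rfl⟩ := hxy
        rw [← cemb_left p q i, ← cemb_right hpq i]
        exact h1 _ _ _
      | refl x => exact .refl _
      | symm x y _ ih => exact .symm _ _ ih
      | trans x y z _ _ ih₁ ih₂ => exact .trans _ _ _ ih₁ ih₂
    have h3 : ∀ x, ∃ u, Relation.EqvGen r x (.inl u) := by
      rintro (u | ⟨i, v⟩)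
      · exact ⟨u, .refl _⟩
      · refine ⟨α.src i, ?_⟩
        rw [← cemb_left p q i, ← cemb_inr]
        exact h1 _ _ _
    intro x y
    obtain ⟨u, hu⟩ := h3 x
    obtain ⟨v, hv⟩ := h3 y
    exact .trans _ _ _ hu (.trans _ _ _ (h2 u v) (.symm _ _ hv))

variable {α B p q}

/-- The extension of a function on the vertices of `α` that is harmonic in the pieces. -/
noncomputable def cext (φ : α.V → ℝ) : ComposeV α B p q → ℝ
  | .inl u => φ u
  | .inr ⟨i, v⟩ => φ (α.src i) + harm (p i) (q i) v.1 * (φ (α.tgt i) - φ (α.src i))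

open Classical in
/-- The Green function of the composite graph with Dirichlet boundary conditions at the vertices of
`α`. -/
noncomputable def cloc : ComposeV α B p q → ComposeV α B p q → ℝ
  | .inr ⟨i, v⟩, .inr ⟨j, w⟩ => if h : i = j then dirichlet (p j) (q j) (h ▸ v.1) w.1 else 0
  | _, _ => 0

/-- The Green function of the composite graph based at a vertex of `α`. -/
noncomputable def cgreen (o : α.V) (y x : ComposeV α B p q) : ℝ :=
  cext (fun u => cext (fun w => α.green o w u) y) x + cloc y x

lemma cext_cemb (hpq : ∀ i, p i ≠ q i) (φ : α.V → ℝ) (i : α.E) (v : (B i).V) :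
    cext φ (cemb p q i v) =
      φ (α.src i) + harm (p i) (q i) v * (φ (α.tgt i) - φ (α.src i)) := by
  rcases cemb_cases hpq i v with rfl | rfl | ⟨h, hv⟩
  · simp [cemb_left, cext]
  · simp [cemb_right hpq, cext, harm_right (hpq i)]
  · rw [hv, cext]

lemma cloc_cemb_self (hpq : ∀ i, p i ≠ q i) (i : α.E) (v w : (B i).V) :
    cloc (cemb p q i v) (cemb p q i w) = dirichlet (p i) (q i) v w := by
  rcases cemb_cases hpq i v with rfl | rfl | ⟨h, hv⟩
  · simp [cemb_left, cloc]
  · simp [cemb_right hpq, cloc, dirichlet_right (hpq i)]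
  rcases cemb_cases hpq i w with rfl | rfl | ⟨h', hw⟩
  · rw [cemb_left, cloc, dirichlet_comm, dirichlet_left]
    simp
  · rw [cemb_right hpq, cloc, dirichlet_comm, dirichlet_right (hpq i)]
    simp
  · simp [hv, hw, cloc]

lemma cloc_cemb_of_ne (hpq : ∀ i, p i ≠ q i) {i j : α.E} (hij : i ≠ j) (v : (B i).V)
    (w : (B j).V) : cloc (cemb p q i v) (cemb p q j w) = 0 := by
  rcases cemb_cases hpq i v with rfl | rfl | ⟨h, hv⟩
  · simp [cemb_left, cloc]
  · simp [cemb_right hpq, cloc]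
  rcases cemb_cases hpq j w with rfl | rfl | ⟨h', hw⟩
  · rw [cemb_left, cloc]
    simp
  · rw [cemb_right hpq, cloc]
    simp
  · simp [hv, hw, cloc, hij]

lemma energy_compose (hpq : ∀ i, p i ≠ q i) (φ ψ : ComposeV α B p q → ℝ) :
    (compose α B p q hpq).energy φ ψ =
      ∑ i, (B i).energy (fun v => φ (cemb p q i v)) (fun v => ψ (cemb p q i v)) :=
  Fintype.sum_sigma _

lemma energy_cext_green (o : α.V) (y : ComposeV α B p q) (φ : α.V → ℝ) :
    α.energy φ (fun u => cext (fun w => α.green o w u) y) = cext φ y - φ o := by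
  rcases y with v | ⟨i, v⟩
  · exact energy_green o v φ
  · change α.energy φ (fun u => α.green o (α.src i) u +
      harm (p i) (q i) v.1 * (α.green o (α.tgt i) u - α.green o (α.src i) u)) = _
    rw [energy_add_right, energy_smul_right, energy_sub_right, energy_green, energy_green]
    simp only [cext]; ring

/-- By `hlen` each piece acts between its terminals as a resistor equal to the edge it replaces, so
the harmonic extension of the Green function of α has the right pairings with functions on α. The
Dirichlet part supplies the rest, inside the piece that contains the pole. -/
lemma isGreen_cgreen (hpq : ∀ i, p i ≠ q i) (hlen : ∀ i, (B i).vres (p i) (q i) = α.len i)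
    (o : α.V) (y : ComposeV α B p q) :
    (compose α B p q hpq).IsGreen (.inl o) y (cgreen o y) where
  energy_eq φ := by
    classical
    have h1 : ∀ i, (B i).energy (fun v => φ (cemb p q i v))
        (fun v => cgreen o y (cemb p q i v)) =
        (φ (.inl (α.tgt i)) - φ (.inl (α.src i))) *
          (cext (fun w => α.green o w (α.tgt i)) y - cext (fun w => α.green o w (α.src i)) y)
            / α.len i +
        (B i).energy (fun v => φ (cemb p q i v)) (fun v => cloc y (cemb p q i v)) := fun i => by
      simp only [cgreen, cext_cemb hpq]
      rw [energy_add_right, energy_add_right, energy_const_right]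
      simp only [mul_comm (harm _ _ _)]
      rw [energy_smul_right, energy_harm, hlen, cemb_left, cemb_right hpq]
      ring
    have h2 : ∑ i, (B i).energy (fun v => φ (cemb p q i v)) (fun v => cloc y (cemb p q i v)) =
        φ y - cext (fun u => φ (.inl u)) y := by
      rcases y with u | ⟨j, v⟩
      · simp [cloc, cext]
      · rw [Finset.sum_eq_single j]
        · rw [← cemb_inr]
          simp only [cloc_cemb_self hpq, cext_cemb hpq]
          rw [energy_dirichlet (hpq j), cemb_left, cemb_right hpq]
        · intro i _ hij
          rw [← cemb_inr]
          simp [cloc_cemb_of_ne hpq hij.symm]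
        · simp
    rw [energy_compose]
    simp only [h1, Finset.sum_add_distrib]
    rw [h2]
    have h3 := energy_cext_green o y fun u => φ (.inl u)
    rw [energy] at h3
    rw [h3]
    ring
  base := by
    rcases y with u | ⟨i, v⟩ <;> simp [cgreen, cext, cloc]

lemma green_compose (hpq : ∀ i, p i ≠ q i) (hlen : ∀ i, (B i).vres (p i) (q i) = α.len i)
    (o : α.V) (y : ComposeV α B p q) :
    (compose α B p q hpq).green (.inl o) y = cgreen o y :=
  (isGreen_cgreen hpq hlen o y).eq

lemma cgreen_cemb_self (hpq : ∀ i, p i ≠ q i) (o : α.V) (i : α.E) (v w : (B i).V) :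
    cgreen o (cemb p q i v) (cemb p q i w) =
      α.green o (α.src i) (α.src i) +
        harm (p i) (q i) v * (α.green o (α.src i) (α.tgt i) - α.green o (α.src i) (α.src i)) +
        harm (p i) (q i) w * (α.green o (α.src i) (α.tgt i) - α.green o (α.src i) (α.src i)) +
        harm (p i) (q i) v * harm (p i) (q i) w * α.eres i +
      dirichlet (p i) (q i) v w := by
  simp only [cgreen, cloc_cemb_self hpq, cext_cemb hpq, eres, vres_eq o,
    green_comm o (α.tgt i) (α.src i)]
  ring

/-- The outside of a piece matters only through the effective resistance it produces between the
terminals, which gives a correction of rank one along the harmonic function. -/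
lemma vres_compose_cemb (hpq : ∀ i, p i ≠ q i) (hlen : ∀ i, (B i).vres (p i) (q i) = α.len i)
    (i : α.E) (v w : (B i).V) :
    (compose α B p q hpq).vres (cemb p q i v) (cemb p q i w) =
      (B i).vres v w + (α.eres i - (B i).vres (p i) (q i)) *
        (harm (p i) (q i) w - harm (p i) (q i) v) ^ 2 := by
  have o := Classical.arbitrary α.V
  rw [vres_eq (Γ := compose α B p q hpq) (.inl o), green_compose hpq hlen, green_compose hpq hlen,
    cgreen_cemb_self hpq, cgreen_cemb_self hpq, cgreen_cemb_self hpq, vres_eq (p i) v w]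
  simp only [dirichlet]
  ring

lemma vres_compose_base (hpq : ∀ i, p i ≠ q i) (hlen : ∀ i, (B i).vres (p i) (q i) = α.len i)
    (o : α.V) (i : α.E) (v : (B i).V) :
    (compose α B p q hpq).vres (.inl o) (cemb p q i v) =
      α.vres o (α.src i) + (B i).vres (p i) v +
        (α.vres o (α.tgt i) - α.vres o (α.src i) - (B i).vres (p i) (q i)) * harm (p i) (q i) v -
        (α.eres i - (B i).vres (p i) (q i)) *
          (harm (p i) (q i) v - harm (p i) (q i) v ^ 2) := by
  rw [vres, green_compose hpq hlen, cgreen_cemb_self hpq, eres, vres_eq o (α.src i)]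
  simp only [dirichlet, vres]
  ring

/-- `tau_of_piece` is applied to every piece with δ the effective resistance of edge i minus its
length. The terms in D² and δ² no longer involve the piece beyond its terminal resistance, and they
add up to `vtau` of α. -/
theorem vtau_compose (hpq : ∀ i, p i ≠ q i) (hlen : ∀ i, (B i).vres (p i) (q i) = α.len i)
    (o : α.V) : (compose α B p q hpq).vtau (.inl o) = α.vtau o +
      ∑ i, ((B i).vtau (p i) - α.len i / 4 + (α.eres i - α.len i) * tauSlope (p i) (q i)) := by
  have h1 : (compose α B p q hpq).vtau (.inl o) = ∑ i, ((B i).vtau (p i) +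
      (α.vres o (α.tgt i) - α.vres o (α.src i)) ^ 2 / (4 * (B i).vres (p i) (q i)) -
      (B i).vres (p i) (q i) / 4 +
      (α.eres i - (B i).vres (p i) (q i)) ^ 2 / (12 * (B i).vres (p i) (q i)) +
      (α.eres i - (B i).vres (p i) (q i)) * tauSlope (p i) (q i)) := by
    rw [vtau, energy_compose, Finset.mul_sum (s := Finset.univ (α := α.E))]
    have h2 : ∑ e, ((compose α B p q hpq).len e - (compose α B p q hpq).eres e) ^ 2 /
        (compose α B p q hpq).len e = ∑ i, ∑ e, ((B i).len e - ((B i).eres e +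
          (α.eres i - (B i).vres (p i) (q i)) *
            (harm (p i) (q i) ((B i).tgt e) - harm (p i) (q i) ((B i).src e)) ^ 2)) ^ 2 /
              (B i).len e := by
      refine (Fintype.sum_sigma _).trans ?_
      refine Finset.sum_congr rfl fun i _ => Finset.sum_congr rfl fun e _ => ?_
      have h3 : (compose α B p q hpq).eres ⟨i, e⟩ = _ :=
        vres_compose_cemb hpq hlen i ((B i).src e) ((B i).tgt e)
      rw [h3]
      rfl
    rw [h2, Finset.mul_sum, ← Finset.sum_add_distrib]
    refine Finset.sum_congr rfl fun i _ => ?_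
    simp only [vres_compose_base hpq hlen]
    exact tau_of_piece (hpq i) _ _ _
  rw [h1, vtau, energy, Finset.mul_sum, Finset.mul_sum, ← Finset.sum_add_distrib,
    ← Finset.sum_add_distrib]
  refine Finset.sum_congr rfl fun i _ => ?_
  have := len_ne_zero i
  rw [hlen]
  field_simp
  ring

end Compose

/-! ### Scaling all lengths -/

section Scale

/-- The metrized graph obtained from `Γ` by multiplying all lengths by `c`. -/
abbrev scale (Γ : MetrizedGraph) (c : ℝ) (hc : 0 < c) : MetrizedGraph :=
  { Γ with
    len := fun e => c * Γ.len e
    len_pos := fun e => mul_pos hc (Γ.len_pos e) }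

variable {c : ℝ} (hc : 0 < c)

lemma energy_scale (φ ψ : Γ.V → ℝ) : (Γ.scale c hc).energy φ ψ = Γ.energy φ ψ / c := by
  simp only [energy, Finset.sum_div]
  exact Finset.sum_congr rfl fun e _ => by rw [div_div, mul_comm c]

lemma green_scale (o y x : Γ.V) : (Γ.scale c hc).green o y x = c * Γ.green o y x := by
  have : (Γ.scale c hc).IsGreen o y fun x => c * Γ.green o y x :=
    ⟨fun φ => by
      rw [energy_scale, energy_smul_right, energy_green, mul_div_cancel_left₀ _ hc.ne'], by simp⟩
  rw [this.eq]

lemma vres_scale (u v : Γ.V) : (Γ.scale c hc).vres u v = c * Γ.vres u v := green_scale hc u v v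

lemma eres_scale (e : Γ.E) : (Γ.scale c hc).eres e = c * Γ.eres e := vres_scale hc _ _

lemma harm_scale (p q v : Γ.V) : harm (Γ := Γ.scale c hc) p q v = harm p q v := by
  rw [harm, green_scale, vres_scale, mul_div_mul_left _ _ hc.ne', harm]

lemma vtau_scale (o : Γ.V) : (Γ.scale c hc).vtau o = c * Γ.vtau o := by
  have h : (Γ.scale c hc).vres o = fun v => c * Γ.vres o v := funext fun v => vres_scale hc o v
  rw [vtau, vtau, h, energy_scale, energy_smul_left, energy_smul_right, mul_add, Finset.mul_sum,
    Finset.mul_sum, Finset.mul_sum]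
  congr 1
  · refine Finset.sum_congr rfl fun e _ => ?_
    have := len_ne_zero e
    rw [eres_scale]
    field_simp
  · field_simp

lemma tauSlope_scale (p q : Γ.V) : tauSlope (Γ := Γ.scale c hc) p q = tauSlope p q := by
  have h : (Γ.scale c hc).vres p = fun v => c * Γ.vres p v := funext fun v => vres_scale hc p v
  rw [tauSlope, tauSlope, h, energy_scale, energy_smul_left, mul_div_cancel_left₀ _ hc.ne']
  simp only [harm_scale]
  congr 2
  refine Finset.sum_congr rfl fun e _ => ?_
  have := len_ne_zero e
  rw [eres_scale]
  field_simp

end Scale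

/-! ### Segments -/

section Path

lemma _root_.Fin.sum_succ_sub_castSucc {n : ℕ} (f : Fin (n + 1) → ℝ) :
    ∑ j : Fin n, (f j.succ - f j.castSucc) = f (Fin.last n) - f 0 := by
  have h1 := Fin.sum_univ_succ f
  rw [Fin.sum_univ_castSucc] at h1
  rw [Finset.sum_sub_distrib]
  linarith

/-- The segment `[s 0, s (n + 1)]`, with vertices at the points `s i`. -/
abbrev path (n : ℕ) (s : Fin (n + 2) → ℝ) (hs : StrictMono s) : MetrizedGraph where
  V := Fin (n + 2)
  E := Fin (n + 1)
  src := Fin.castSucc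
  tgt := Fin.succ
  len e := s e.succ - s e.castSucc
  len_pos e := sub_pos.2 (hs (Fin.castSucc_lt_succ))
  connected := by
    have h : ∀ u : Fin (n + 2), Relation.EqvGen
        (fun a b => ∃ e : Fin (n + 1), e.castSucc = a ∧ e.succ = b) 0 u := by
      intro u
      induction u using Fin.induction with
      | zero => exact .refl _
      | succ i ih => exact .trans _ _ _ ih (.rel _ _ ⟨i, rfl, rfl⟩)
    exact fun u v => .trans _ _ _ (.symm _ _ (h u)) (h v)

variable {n : ℕ} {s : Fin (n + 2) → ℝ} (hs : StrictMono s)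

lemma green_path (v w : Fin (n + 2)) :
    (path n s hs).green 0 v w = min (s v) (s w) - s 0 := by
  have : (path n s hs).IsGreen 0 v fun w => min (s v) (s w) - s 0 := by
    refine ⟨fun φ => ?_, by simp [hs.monotone (Fin.zero_le v)]⟩
    -- The candidate has slope 1 before v and slope 0 after it, so the energy telescopes along the
    -- path and stops at v.
    have h1 : ∀ j : Fin (n + 1), (φ j.succ - φ j.castSucc) *
        ((min (s v) (s j.succ) - s 0) - (min (s v) (s j.castSucc) - s 0)) /
          (s j.succ - s j.castSucc) = φ (min v j.succ) - φ (min v j.castSucc) := by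
      intro j
      have hj : s j.castSucc < s j.succ := hs Fin.castSucc_lt_succ
      rcases le_or_gt v j.castSucc with h | h
      · have h' : v ≤ j.succ := h.trans Fin.castSucc_lt_succ.le
        rw [min_eq_left h, min_eq_left h', min_eq_left (hs.monotone h),
          min_eq_left (hs.monotone h')]
        simp
      · have h' : j.succ ≤ v := Fin.castSucc_lt_iff_succ_le.1 h
        rw [min_eq_right h.le, min_eq_right h', min_eq_right (hs.monotone h.le),
          min_eq_right (hs.monotone h'), sub_sub_sub_cancel_right,
          mul_div_cancel_right₀ _ (sub_pos.2 hj).ne']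
    simp only [energy, h1]
    rw [Fin.sum_succ_sub_castSucc (fun j => φ (min v j)), min_eq_left (Fin.le_last v),
      min_eq_right (Fin.zero_le v)]
  rw [this.eq]

lemma vres_path (v : Fin (n + 2)) : (path n s hs).vres 0 v = s v - s 0 := by
  rw [vres, green_path, min_self]

lemma harm_path (v : Fin (n + 2)) : harm (Γ := path n s hs) 0 (Fin.last (n + 1)) v =
    (s v - s 0) / (s (Fin.last (n + 1)) - s 0) := by
  rw [harm, vres_path, green_path, min_eq_right (hs.monotone (Fin.le_last v))]

lemma eres_path (e : Fin (n + 1)) : (path n s hs).eres e = s e.succ - s e.castSucc := by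
  rw [eres, vres_eq (Γ := path n s hs) (0 : Fin (n + 2)), green_path, green_path, green_path, min_self, min_self,
    min_eq_left (hs Fin.castSucc_lt_succ).le]
  ring

lemma vtau_path : (path n s hs).vtau 0 = (s (Fin.last (n + 1)) - s 0) / 4 := by
  simp only [vtau, eres_path, energy, vres_path, sub_self, sub_sub_sub_cancel_right]
  rw [← Fin.sum_succ_sub_castSucc s, Finset.mul_sum, Finset.mul_sum, Finset.sum_div,
    ← Finset.sum_add_distrib]
  refine Finset.sum_congr rfl fun e _ => ?_
  have : s e.succ - s e.castSucc ≠ 0 := (sub_pos.2 (hs Fin.castSucc_lt_succ)).ne'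
  field_simp
  ring

lemma zero_ne_fin_last : (0 : Fin (n + 2)) ≠ Fin.last (n + 1) := (Fin.last_pos (n := n)).ne

/-- Every edge is a bridge, so length equals effective resistance and the first sum vanishes. The
resistance from 0 is a multiple of the harmonic function h, whose pairing with h - h² vanishes since
h - h² is 0 at both ends. -/
lemma tauSlope_path : tauSlope (Γ := path n s hs) 0 (Fin.last (n + 1)) = 0 := by
  have h : (0 : (path n s hs).V) ≠ Fin.last (n + 1) := zero_ne_fin_last
  have h1 : (path n s hs).vres 0 = fun v => (path n s hs).vres 0 (Fin.last (n + 1)) *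
      harm (Γ := path n s hs) 0 (Fin.last (n + 1)) v := by
    funext v
    rw [vres_mul_harm h, green_path, vres_path, min_eq_right (hs.monotone (Fin.le_last v))]
  rw [tauSlope, h1, energy_smul_left, energy_comm, energy_harm, harm_left, harm_right h]
  simp [eres_path]

end Path

/-! ### Subdivisions as compositions with segments -/

section Subdivide

variable (n : Γ.E → ℕ) (s : ∀ e, Fin (n e + 2) → ℝ) (hs : ∀ e, StrictMono (s e))

/-- The subdivision of `Γ` with vertices at the points `s e i` of the edges `e`. -/
noncomputable abbrev subdivide : MetrizedGraph :=
  compose Γ (fun e => path (n e) (s e) (hs e)) (fun _ => (0 : Fin _)) (fun _ => Fin.last _)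
    fun _ => zero_ne_fin_last

/-- The position in `Γ` of a vertex of a subdivision. -/
noncomputable def toPoint : (subdivide n s hs).V → Γ.Point
  | .inl u => .vertex u
  | .inr ⟨e, v⟩ => Γ.edgePoint e (s e v.1)

variable {n s} (h₀ : ∀ e, s e 0 = 0) (h₁ : ∀ e, s e (Fin.last _) = Γ.len e)

include h₀ h₁ in
lemma vres_path_ends (e : Γ.E) : (path (n e) (s e) (hs e)).vres 0 (Fin.last _) = Γ.len e := by
  rw [vres_path, h₀, h₁, sub_zero]

include hs h₀ h₁ in
lemma subdivide_pos_mem (e : Γ.E) (v : Fin (n e + 2)) : s e v ∈ Set.Icc 0 (Γ.len e) :=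
  ⟨(h₀ e).symm.trans_le ((hs e).monotone (Fin.zero_le v)),
    ((hs e).monotone (Fin.le_last v)).trans_eq (h₁ e)⟩

-- A segment has tau constant a quarter of its length and `tauSlope` zero, so all corrections in
-- `vtau_compose` vanish.
include h₀ h₁ in
lemma vtau_subdivide (o : Γ.V) : (subdivide n s hs).vtau (.inl o) = Γ.vtau o := by
  rw [vtau_compose (hlen := vres_path_ends hs h₀ h₁)]
  simp only [vtau_path, tauSlope_path, h₀, h₁]
  simp

include h₀ h₁ in
lemma tau_subdivide : (subdivide n s hs).tau = Γ.tau := by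
  have o := Classical.arbitrary Γ.V
  rw [tau_eq o, ← vtau_subdivide hs h₀ h₁ o, tau_eq]

include h₀ h₁ in
lemma totalLength_subdivide : (subdivide n s hs).totalLength = Γ.totalLength := by
  rw [totalLength, totalLength]
  refine (Fintype.sum_sigma _).trans (Finset.sum_congr rfl fun e _ => ?_)
  rw [← h₁ e, ← sub_zero (s e _), ← h₀ e]
  exact Fin.sum_succ_sub_castSucc (s e)

include h₀ h₁ in
lemma cext_toPoint (φ : Γ.V → ℝ) (x : (subdivide n s hs).V) :
    cext φ x = pext φ (toPoint n s hs x) := by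
  rcases x with u | ⟨e, v⟩
  · rfl
  · rw [toPoint, pext_edgePoint _ (subdivide_pos_mem hs h₀ h₁ e v.1), cext, harm_path, h₀, h₁,
      sub_zero, sub_zero]

include h₀ h₁ in
lemma cloc_toPoint (y x : (subdivide n s hs).V) :
    cloc y x = ploc (toPoint n s hs y) (toPoint n s hs x) := by
  rcases y with u | ⟨e, v⟩
  · rw [toPoint, ploc_comm]
    simp [cloc, ploc]
  rcases x with u | ⟨e', w⟩
  · simp [cloc, toPoint, ploc]
  have hv : 0 < s e v.1 := (h₀ e).symm.trans_lt (hs e (Fin.pos_iff_ne_zero.2 v.2.1))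
  have hv' : s e v.1 < Γ.len e := (hs e (Fin.lt_last_iff_ne_last.2 v.2.2)).trans_eq (h₁ e)
  simp only [toPoint]
  rw [ploc_edgePoint _ (subdivide_pos_mem hs h₀ h₁ e' w.1), edgePoint_interior hv hv']
  by_cases h : e = e'
  · subst h
    simp only [cloc, pos, dite_true, if_true, dirichlet, green_path, harm_path, vres_path, h₀, h₁,
      sub_zero]
    have := len_ne_zero e
    rw [min_comm]
    field_simp
  · simp [cloc, pos, h, (subdivide_pos_mem hs h₀ h₁ e' w.1).1]

-- On a segment, harmonic means affine and the Dirichlet Green function is the tent, so the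
-- composite Green function agrees with `pgreen`. This makes resistances between arbitrary points
-- accessible as resistances between vertices.
include h₀ h₁ in
lemma vres_subdivide (x y : (subdivide n s hs).V) : (subdivide n s hs).vres x y =
    Γ.resistance (toPoint n s hs x) (toPoint n s hs y) := by
  have o := Classical.arbitrary Γ.V
  have h : ∀ y x : (subdivide n s hs).V, (subdivide n s hs).green (.inl o) y x =
      pgreen o (toPoint n s hs y) (toPoint n s hs x) := by
    intro y x
    rw [green_compose (hlen := vres_path_ends hs h₀ h₁), cgreen, cext_toPoint hs h₀ h₁,
      cloc_toPoint hs h₀ h₁, pgreen]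
    simp only [cext_toPoint hs h₀ h₁]
    rfl
  rw [vres_eq (Γ := subdivide n s hs) (.inl o), h, h, h, resistance_eq o]

include h₀ h₁ in
lemma exists_toPoint_eq (x : Γ.Point) (hx : ∀ e, pos e x ∈ Set.range (s e)) :
    ∃ x', toPoint n s hs x' = x := by
  rcases x with u | ⟨e, t, ht₀, ht₁⟩
  · exact ⟨.inl u, rfl⟩
  · obtain ⟨v, hv⟩ := hx e
    rw [pos_interior_self] at hv
    refine ⟨.inr ⟨e, v, ?_, ?_⟩, ?_⟩
    · rintro rfl
      rw [h₀] at hv; exact ht₀.ne hv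
    · rintro rfl
      rw [h₁] at hv; exact ht₁.ne' hv
    · rw [toPoint, hv, edgePoint_interior ht₀ ht₁]

-- The quadratic dependence on the length of the part is what makes the error term tend to 0 under
-- refinement.
include h₀ h₁ in
lemma len_sub_eres_subdivide (e : Γ.E) (j : Fin (n e + 1)) :
    (subdivide n s hs).len ⟨e, j⟩ - (subdivide n s hs).eres ⟨e, j⟩ =
      (Γ.len e - Γ.eres e) * ((s e j.succ - s e j.castSucc) / Γ.len e) ^ 2 := by
  have h : (subdivide n s hs).eres ⟨e, j⟩ = (path (n e) (s e) (hs e)).eres j +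
      (Γ.eres e - (path (n e) (s e) (hs e)).vres 0 (Fin.last _)) *
        (harm (Γ := path (n e) (s e) (hs e)) 0 (Fin.last _) j.succ -
          harm (Γ := path (n e) (s e) (hs e)) 0 (Fin.last _) j.castSucc) ^ 2 :=
    vres_compose_cemb _ (vres_path_ends hs h₀ h₁) e j.castSucc j.succ
  rw [h, vres_path_ends hs h₀ h₁, eres_path, harm_path, harm_path, h₀, h₁]
  simp only [sub_zero]
  ring

end Subdivide

lemma exists_partition {L : ℝ} (hL : 0 < L) {T : Finset ℝ} (hT : ∀ t ∈ T, t ∈ Set.Icc 0 L) :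
    ∃ (n : ℕ) (s : Fin (n + 2) → ℝ), StrictMono s ∧ s 0 = 0 ∧ s (Fin.last _) = L ∧
      ∀ t ∈ T, t ∈ Set.range s := by
  set S : Finset ℝ := insert 0 (insert L T) with hS
  have h0 : (0 : ℝ) ∈ S := by simp [hS]
  have h1 : L ∈ S := by simp [hS]
  have hmem : ∀ t ∈ S, t ∈ Set.Icc 0 L := by
    intro t ht
    rcases Finset.mem_insert.1 ht with rfl | ht
    · exact ⟨le_rfl, hL.le⟩
    rcases Finset.mem_insert.1 ht with rfl | ht
    · exact ⟨hL.le, le_rfl⟩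
    · exact hT t ht
  obtain ⟨n, hn⟩ : ∃ n, S.card = n + 2 := by
    have : 1 < S.card := Finset.one_lt_card.2 ⟨0, h0, L, h1, hL.ne⟩
    exact ⟨S.card - 2, by omega⟩
  have hrange := Finset.range_orderEmbOfFin S hn
  have hin : ∀ t ∈ S, t ∈ Set.range (S.orderEmbOfFin hn) := fun t ht => by rw [hrange]; exact ht
  have hIcc : ∀ j, S.orderEmbOfFin hn j ∈ Set.Icc 0 L := fun j =>
    hmem _ (Finset.orderEmbOfFin_mem S hn j)
  refine ⟨n, S.orderEmbOfFin hn, (S.orderEmbOfFin hn).strictMono, ?_, ?_, fun t ht =>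
    hin t (by simp [hS, ht])⟩
  · obtain ⟨j, hj⟩ := hin 0 h0
    exact le_antisymm (((S.orderEmbOfFin hn).monotone (Fin.zero_le j)).trans_eq hj) (hIcc _).1
  · obtain ⟨j, hj⟩ := hin L h1
    exact le_antisymm (hIcc _).2 (hj.symm.trans_le ((S.orderEmbOfFin hn).monotone (Fin.le_last j)))

/-- Any two points are vertices of a suitable subdivision. -/
lemma exists_subdivision_of_points (p q : Γ.Point) : ∃ (Γ' : MetrizedGraph) (p' q' : Γ'.V),
    Γ'.totalLength = Γ.totalLength ∧ Γ'.tau = Γ.tau ∧ Γ'.vres p' q' = Γ.resistance p q ∧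
      (p ≠ q → p' ≠ q') := by
  classical
  have h : ∀ e : Γ.E, _ := fun e => exists_partition (Γ.len_pos e) (T := {pos e p, pos e q}) (by
    intro t ht
    simp only [Finset.mem_insert, Finset.mem_singleton] at ht
    rcases ht with rfl | rfl
    · exact ⟨pos_nonneg e p, (pos_lt e p).le⟩
    · exact ⟨pos_nonneg e q, (pos_lt e q).le⟩)
  choose n s hs h₀ h₁ hT using h
  obtain ⟨p', hp⟩ := exists_toPoint_eq hs h₀ h₁ p fun e => hT e _ (by simp)
  obtain ⟨q', hq⟩ := exists_toPoint_eq hs h₀ h₁ q fun e => hT e _ (by simp)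
  refine ⟨subdivide n s hs, p', q', totalLength_subdivide hs h₀ h₁, tau_subdivide hs h₀ h₁, ?_, ?_⟩
  · rw [vres_subdivide hs h₀ h₁, hp, hq]
  · rintro hpq rfl
    exact hpq (hp.symm.trans hq)

/-- The subdivision of every edge into `n + 1` equal parts. -/
lemma exists_equal_subdivision (Γ : MetrizedGraph) (n : ℕ) : ∃ Γ' : MetrizedGraph,
    Γ'.totalLength = Γ.totalLength ∧ Γ'.tau = Γ.tau ∧
      ∑ e, (Γ'.len e - Γ'.eres e) = (∑ e, (Γ.len e - Γ.eres e)) / (n + 1) := by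
  have hn : (n : ℝ) + 1 ≠ 0 := by positivity
  let s : ∀ _ : Γ.E, Fin (n + 2) → ℝ := fun e j => j.1 * (Γ.len e / (n + 1))
  have hs : ∀ e, StrictMono (s e) := fun e i j hij =>
    mul_lt_mul_of_pos_right (Nat.cast_lt.2 hij) (div_pos (Γ.len_pos e) (by positivity))
  have h₀ : ∀ e, s e 0 = 0 := fun e => by simp [s]
  have h₁ : ∀ e, s e (Fin.last _) = Γ.len e := fun e => by
    simp only [s, Fin.val_last]
    push_cast
    field_simp
  refine ⟨subdivide (fun _ => n) s hs, totalLength_subdivide hs h₀ h₁, tau_subdivide hs h₀ h₁, ?_⟩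
  rw [Finset.sum_div]
  refine (Fintype.sum_sigma _).trans (Finset.sum_congr rfl fun e _ => ?_)
  -- Each of the n + 1 parts carries 1 / (n + 1)² of the defect of its edge, so the total drops by
  -- the factor n + 1.
  have h : ∀ j : Fin (n + 1), (subdivide (fun _ => n) s hs).len ⟨e, j⟩ -
      (subdivide (fun _ => n) s hs).eres ⟨e, j⟩ = (Γ.len e - Γ.eres e) * (1 / (n + 1)) ^ 2 := by
    intro j
    rw [len_sub_eres_subdivide hs h₀ h₁]
    have := len_ne_zero e
    simp only [s, Fin.val_succ, Fin.val_castSucc]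
    push_cast
    field_simp
    ring
  refine (Finset.sum_congr rfl fun j _ => h j).trans ?_
  rw [Finset.sum_const, Finset.card_univ, Fintype.card_fin, nsmul_eq_mul]
  push_cast
  field_simp

/-! ### The construction of Γ' -/

/-- Replacing the edges of a fine subdivision of `Γ` by scaled copies of `Γ`. -/
theorem exists_tau_le {Γ : MetrizedGraph} (hΓ : Γ.IsNormalized) (p q : Γ.Point) {ε : ℝ}
    (hε : 0 < ε) : ∃ Γ' : MetrizedGraph, Γ'.IsNormalized ∧
      Γ'.tau ≤ Γ.tau - Γ.resistance p q * (1 / 4 - Γ.tau) + ε := by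
  rcases eq_or_ne p q with rfl | hpq
  · refine ⟨Γ, hΓ, ?_⟩
    rw [resistance_eq (Classical.arbitrary Γ.V)]
    linarith
  obtain ⟨Γ₁, p', q', hlen₁, htau₁, hres, hne⟩ := exists_subdivision_of_points p q
  have hpq' := hne hpq
  have hR : 0 < Γ₁.vres p' q' := vres_pos hpq'
  set R := Γ₁.vres p' q' with hRdef
  set K := ∑ e, (Γ.len e - Γ.eres e)
  set b := tauSlope p' q'
  -- This choice makes the error R b K / (n + 1) at most ε in absolute value.
  obtain ⟨n, hn⟩ := exists_nat_gt (|R * b * K| / ε)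
  obtain ⟨Γ₂, hlen₂, htau₂, hsum₂⟩ := exists_equal_subdivision Γ n
  -- The factor R makes the i-th edge as long as the terminal resistance R L_i of the copy replacing
  -- it; the copies, scaled by L_i, keep the total length equal to 1.
  let α := Γ₂.scale R hR
  let B : α.E → MetrizedGraph := fun i => Γ₁.scale (Γ₂.len i) (Γ₂.len_pos i)
  let P : ∀ i, (B i).V := fun _ => p'
  let Q : ∀ i, (B i).V := fun _ => q'
  have hPQ : ∀ i, P i ≠ Q i := fun _ => hpq'
  have hlen : ∀ i, (B i).vres (P i) (Q i) = α.len i := fun i => by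
    have : (B i).vres (P i) (Q i) = Γ₂.len i * R := vres_scale (Γ₂.len_pos i) p' q'
    rw [this, mul_comm]
  have hsumlen : ∑ i, Γ₂.len i = 1 := hlen₂.trans hΓ
  refine ⟨compose α B P Q hPQ, ?_, ?_⟩
  · have : (compose α B P Q hPQ).totalLength = ∑ i, ∑ e, Γ₂.len i * Γ₁.len e :=
      Fintype.sum_sigma _
    have h1 : ∑ e, Γ₁.len e = 1 := hlen₁.trans hΓ
    rw [IsNormalized, this]
    simp only [← Finset.mul_sum, h1, mul_one, hsumlen]
  · have o := Classical.arbitrary Γ₂.V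
    have h1 : ∀ i, (B i).vtau (P i) = Γ₂.len i * Γ.tau := fun i => by
      rw [← htau₁, tau_eq p']; exact vtau_scale _ _
    have h2 : ∀ i, tauSlope (P i) (Q i) = b := fun i => tauSlope_scale (Γ₂.len_pos i) p' q'
    have h3 : ∀ i : Γ₂.E, α.eres i = R * Γ₂.eres i := fun i => eres_scale hR i
    have h4 : α.vtau o = R * Γ.tau := by
      rw [← htau₂, tau_eq o]; exact vtau_scale hR o
    have h5 : (compose α B P Q hPQ).tau = R * Γ.tau +
        ∑ i, (Γ₂.len i * Γ.tau - R * Γ₂.len i / 4 + (R * Γ₂.eres i - R * Γ₂.len i) * b) := by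
      rw [tau_eq (Γ := compose α B P Q hPQ) (.inl o), vtau_compose hPQ hlen, h4]
      simp only [h1, h2, h3]
      rfl
    have h6 : ∑ i, (Γ₂.len i * Γ.tau - R * Γ₂.len i / 4 + (R * Γ₂.eres i - R * Γ₂.len i) * b) =
        (∑ i, Γ₂.len i) * (Γ.tau - R / 4) - R * b * ∑ i, (Γ₂.len i - Γ₂.eres i) := by
      rw [Finset.sum_mul, Finset.mul_sum, ← Finset.sum_sub_distrib]
      exact Finset.sum_congr rfl fun i _ => by ring
    have h7 : -(R * b * (K / (n + 1))) ≤ ε := by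
      have hn1 : (0 : ℝ) < n + 1 := by positivity
      rw [div_lt_iff₀ hε] at hn
      rw [← mul_div_assoc, ← neg_div, div_le_iff₀ hn1]
      nlinarith [neg_abs_le (R * b * K)]
    rw [h5, h6, hsumlen, hsum₂, ← hres]
    linarith

/-! ### No normalized graph attains the constant of the conjecture -/

/-- The circle of length `1`. -/
abbrev circle : MetrizedGraph where
  V := Unit
  E := Unit
  src := id
  tgt := id
  len _ := 1
  len_pos _ := one_pos
  connected _ _ := .refl _

lemma tau_circle : circle.tau = 1 / 12 := by
  rw [tau_eq ()]
  simp [vtau, energy, eres]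

lemma resistance_pos {p q : Γ.Point} (hpq : p ≠ q) : 0 < Γ.resistance p q := by
  obtain ⟨Γ', p', q', -, -, hres, hne⟩ := exists_subdivision_of_points p q
  rw [← hres]
  exact vres_pos (hne hpq)

theorem tau_ne_of_lowerBoundConjecture {C : ℝ} (hC : LowerBoundConjecture C) {β : MetrizedGraph}
    (hβ : β.IsNormalized) : β.tau ≠ C := by
  intro hτ
  -- All that matters here is C < 1/4, so that the gain r(p, q) (1/4 - C) is positive; half of it
  -- serves as ε.
  have h1 : C ≤ 1 / 12 := by
    have := hC.2 circle
    rw [tau_circle] at this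
    simpa [totalLength] using this
  -- Total length 1 forces an edge, and an edge provides two distinct points.
  have : Nonempty β.E := by
    by_contra h
    rw [not_nonempty_iff] at h
    simp [IsNormalized, totalLength] at hβ
  obtain ⟨e⟩ := this
  have hL := β.len_pos e
  obtain ⟨p, q, hpq⟩ : ∃ p q : β.Point, p ≠ q :=
    ⟨.vertex (β.src e), .interior e (β.len e / 2) (by linarith) (by linarith), by simp⟩
  have hpos : 0 < β.resistance p q * (1 / 4 - C) := mul_pos (resistance_pos hpq) (by linarith)
  obtain ⟨Γ', hΓ', hle⟩ := exists_tau_le hβ p q (half_pos hpos)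
  have h2 := hC.2 Γ'
  rw [hΓ', mul_one] at h2
  rw [hτ] at hle
  linarith

end MetrizedGraph

theorem mainTheorem11 :
    (∀ Γ : MetrizedGraph, Γ.IsNormalized → ∀ p q : Γ.Point, ∀ ε : ℝ, 0 < ε →
      ∃ Γ' : MetrizedGraph, Γ'.IsNormalized ∧
        Γ'.tau ≤ Γ.tau - Γ.resistance p q * (1 / 4 - Γ.tau) + ε) ∧
    (∀ C : ℝ, MetrizedGraph.LowerBoundConjecture C →
      ¬ ∃ β : MetrizedGraph, β.IsNormalized ∧ β.tau = C) :=
  ⟨fun _ hΓ p q _ hε => MetrizedGraph.exists_tau_le hΓ p q hε,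
    fun _ hC ⟨_, hβ, hτ⟩ => MetrizedGraph.tau_ne_of_lowerBoundConjecture hC hβ hτ⟩
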